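/- **Setting.** There are $n\ge 1$ players and $m\ge 1$ items. A valuation is a non-decreasing function $v:2^{[m]}\to\mathbb R$ with $v(\emptyset)=0$. It is XOS if $v(S)=\max_{1\le l\le t}\sum_{j\in S}a_{l,j}$ for finitely many additive functions $a_1,\dots,a_t$, and subadditive if $v(S\cup T)\le v(S)+v(T)$ for all $S,T$. An allocation is a tuple $(S_1,\dots,S_n)$ of pairwise disjoint bundles (items may be left over), with Nash social welfare $\mathrm{NSW}(S_1,\dots,S_n)=\bigl(\prod_i v_i(S_i)\bigr)^{1/n}$. A deterministic mechanism with percentage fees consists of an allocation rule $f$ and fees $p_i(v)\in[0,1)$; the profit of player $i$ is $(1-p_i(v))\,v_i(f(v))$. The mechanism is incentive compatible if reporting the true valuation is a dominant strategy for every player, i.e. $(1-p_i(v))\,v_i(f(v))\ge(1-p_i(v_i',v_{-i}))\,v_i(f(v_i',v_{-i}))$ for all $v,i,v_i'$. It is an $\alpha$-approximation on $v$ if $\mathrm{NSW}(a)\le\alpha\,\mathrm{NSW}(f(v))$ for every allocation $a$. **Theorem.** There is an absolute constant $c>0$ such that for every $\varepsilon>0$ there is one program $P$, for a random access machine with value queries,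 with the following property. For every $n\ge1$ there is a constant $C$ (depending only on $\varepsilon$ and $n$) such that for every $m\ge 1$ there is a deterministic mechanism with percentage fees in $[0,1)$, defined for all profiles of $n$ valuations on $m$ items, such that: 1. the mechanism is incentive compatible; 2. it is maximal-in-range over the support of an $n$-wise independent distribution: there is a probability distribution $\mathcal D$ on $[n]^{[m]}$ (assignments of all items to the players) for which the owners of any at most $n$ items are independent and each item $j$ goes to each player $i$ with probability in $\bigl[\frac{1-\varepsilon}{n},\frac{1+\varepsilon}{n}\bigr]$, such that on every profile $f$ selects an allocation of highest NSW among the support of $\mathcal D$ and the allocation that allocates nothing; 3. on input $n,m$ and with access to the valuations by value queries, $P$ computes the allocation and all the fees in at most $C\cdot m^n$ steps, where each value query, each operation on integers (words, bounded by $C\cdot m^n$) and each arithmetic operation or comparison on reals is one step; 4. if all valuations are XOS, the mechanism is a $(1+\varepsilon)n$-approximation to the Nash social welfare; 5. if all valuations are subadditive and $m\ge2$, the mechanism is a $c\,n\log m$-approximation to the Nash social welfare. -/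

import Mathlib

open MeasureTheory ProbabilityTheory

noncomputable section

namespace PercentageFee

/-! ### Combinatorial auctions -/

/-- A valuation on `m` items: a non-decreasing set function with value `0` on the empty bundle. -/
structure Valuation (m : ℕ) where
  val : Finset (Fin m) → ℝ
  mono : ∀ S T : Finset (Fin m), S ⊆ T → val S ≤ val T
  empty : val ∅ = 0

/-- `v` is XOS: a pointwise maximum of finitely many additive functions. -/
def Valuation.IsXOS {m : ℕ} (v : Valuation m) : Prop :=
  ∃ (t : ℕ) (a : Fin t → Fin m → ℝ),
    ∀ S : Finset (Fin m), IsGreatest (Set.range fun l : Fin t => ∑ j ∈ S, a l j) (v.val S)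

/-- `v` is subadditive. -/
def Valuation.IsSubadditive {m : ℕ} (v : Valuation m) : Prop :=
  ∀ S T : Finset (Fin m), v.val (S ∪ T) ≤ v.val S + v.val T

/-- An allocation tells for each item who gets it; `none` means that the item is left over. -/
abbrev Allocation (n m : ℕ) : Type := Fin m → Option (Fin n)

/-- The bundle of player `i`. -/
def bundle {n m : ℕ} (a : Allocation n m) (i : Fin n) : Finset (Fin m) :=
  Finset.univ.filter fun j => a j = some i

/-- The allocation that allocates nothing. -/
def nullAllocation (n m : ℕ) : Allocation n m := fun _ => none

/-- The Nash social welfare: the geometric mean of the players' values. -/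
def nsw {n m : ℕ} (v : Fin n → Valuation m) (a : Allocation n m) : ℝ :=
  (∏ i, (v i).val (bundle a i)) ^ (1 / (n : ℝ))

/-! ### Mechanisms with percentage fees -/

/-- A deterministic direct mechanism: an allocation rule, and for each player the fraction
of her value of the outcome that she is charged. -/
structure Mechanism (n m : ℕ) where
  alloc : (Fin n → Valuation m) → Allocation n m
  fee : (Fin n → Valuation m) → Fin n → ℝ

/-- All fees are in `[0, 1)`: individual rationality and no positive transfers. -/
def Mechanism.FeesInRange {n m : ℕ} (M : Mechanism n m) : Prop :=
  ∀ (v : Fin n → Valuation m) (i : Fin n), 0 ≤ M.fee v i ∧ M.fee v i < 1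

/-- The profit of player `i` with true valuation `u` when the reported profile is `v`. -/
def Mechanism.profit {n m : ℕ} (M : Mechanism n m) (i : Fin n) (u : Valuation m)
    (v : Fin n → Valuation m) : ℝ :=
  (1 - M.fee v i) * u.val (bundle (M.alloc v) i)

/-- Reporting the true valuation is a dominant strategy for every player. -/
def Mechanism.IncentiveCompatible {n m : ℕ} (M : Mechanism n m) : Prop :=
  ∀ (v : Fin n → Valuation m) (i : Fin n) (u : Valuation m),
    M.profit i (v i) (Function.update v i u) ≤ M.profit i (v i) v

/-- On the profile `v` the mechanism is within a factor `α` of the optimal Nash social welfare. -/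
def Mechanism.ApproximatesNSW {n m : ℕ} (M : Mechanism n m) (α : ℝ)
    (v : Fin n → Valuation m) : Prop :=
  ∀ a : Allocation n m, nsw v a ≤ α * nsw v (M.alloc v)

/-- The mechanism always selects, from the fixed set `R`, an allocation of highest Nash
social welfare. -/
def Mechanism.MaximalInRange {n m : ℕ} (M : Mechanism n m) (R : Set (Allocation n m)) : Prop :=
  ∀ v : Fin n → Valuation m, M.alloc v ∈ R ∧ ∀ a ∈ R, nsw v a ≤ nsw v (M.alloc v)

/-! ### `k`-wise independent distributions -/

/-- The owners of any `k` (or fewer) items are independent random variables. -/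
def KWiseIndependent {n m : ℕ} (k : ℕ) (D : PMF (Fin m → Fin n)) : Prop :=
  ∀ J : Finset (Fin m), J.card ≤ k →
    iIndepFun (fun (j : J) (g : Fin m → Fin n) => g (j : Fin m)) D.toMeasure

/-- The owner of every single item is uniform on the players up to a relative error `ε`. -/
def NearlyUniform {n m : ℕ} (ε : ℝ) (D : PMF (Fin m → Fin n)) : Prop :=
  ∀ (j : Fin m) (i : Fin n), |D.toMeasure.real {g | g j = i} - 1 / (n : ℝ)| ≤ ε / (n : ℝ)

/-- The support of `D`, as a set of allocations (of all items), together with the allocation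
that allocates nothing. -/
def supportRange {n m : ℕ} (D : PMF (Fin m → Fin n)) : Set (Allocation n m) :=
  insert (nullAllocation n m) ((fun (g : Fin m → Fin n) (j : Fin m) => some (g j)) '' D.support)

/-! ### The machine model: a random access machine with value queries

The memory consists of integer arrays and real arrays, each cell of which is read or written in
one step; a program names finitely many arrays. Integer cells hold words, bounded
by a parameter `W`. Reals are handled exactly, but only by arithmetic and comparisons. -/

/-- The memory: cell `k` of the integer array `a` is `nat a k`, and similarly for `real`. -/
structure Store where
  nat : ℕ → ℕ → ℕ
  real : ℕ → ℕ → ℝ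

def Store.setNat (s : Store) (a k x : ℕ) : Store :=
  { s with nat := Function.update s.nat a (Function.update (s.nat a) k x) }

def Store.setReal (s : Store) (a k : ℕ) (x : ℝ) : Store :=
  { s with real := Function.update s.real a (Function.update (s.real a) k x) }

/-- Integer expressions. -/
inductive NExp where
  | lit (k : ℕ)
  | get (a : ℕ) (e : NExp)
  | add (e f : NExp)
  | sub (e f : NExp)
  | mul (e f : NExp)
  | div (e f : NExp)
  | mod (e f : NExp)

/-- The value of an integer expression (subtraction is truncated). -/
def NExp.eval (s : Store) : NExp → ℕ
  | .lit k => k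
  | .get a e => s.nat a (e.eval s)
  | .add e f => e.eval s + f.eval s
  | .sub e f => e.eval s - f.eval s
  | .mul e f => e.eval s * f.eval s
  | .div e f => e.eval s / f.eval s
  | .mod e f => e.eval s % f.eval s

/-- The time to evaluate an integer expression: one step for each operation. -/
def NExp.cost : NExp → ℕ
  | .lit _ => 1
  | .get _ e => e.cost + 1
  | .add e f | .sub e f | .mul e f | .div e f | .mod e f => e.cost + f.cost + 1

/-- Every intermediate result fits into a word. -/
def NExp.Fits (W : ℕ) (s : Store) : NExp → Prop
  | .lit k => k ≤ W
  | .get a e => e.Fits W s ∧ s.nat a (e.eval s) ≤ W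
  | .add e f => e.Fits W s ∧ f.Fits W s ∧ e.eval s + f.eval s ≤ W
  | .sub e f => e.Fits W s ∧ f.Fits W s
  | .mul e f => e.Fits W s ∧ f.Fits W s ∧ e.eval s * f.eval s ≤ W
  | .div e f => e.Fits W s ∧ f.Fits W s
  | .mod e f => e.Fits W s ∧ f.Fits W s

/-- Real expressions; there is no conversion of reals to integers. -/
inductive RExp where
  | zero
  | one
  | get (a : ℕ) (e : NExp)
  | add (e f : RExp)
  | sub (e f : RExp)
  | mul (e f : RExp)
  | div (e f : RExp)

def RExp.eval (s : Store) : RExp → ℝ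
  | .zero => 0
  | .one => 1
  | .get a e => s.real a (e.eval s)
  | .add e f => e.eval s + f.eval s
  | .sub e f => e.eval s - f.eval s
  | .mul e f => e.eval s * f.eval s
  | .div e f => e.eval s / f.eval s

def RExp.cost : RExp → ℕ
  | .zero => 1
  | .one => 1
  | .get _ e => e.cost + 1
  | .add e f | .sub e f | .mul e f | .div e f => e.cost + f.cost + 1

/-- The addresses fit into a word, and no division by zero occurs. -/
def RExp.Fits (W : ℕ) (s : Store) : RExp → Prop
  | .zero => True
  | .one => True
  | .get _ e => e.Fits W s
  | .add e f => e.Fits W s ∧ f.Fits W s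
  | .sub e f => e.Fits W s ∧ f.Fits W s
  | .mul e f => e.Fits W s ∧ f.Fits W s
  | .div e f => e.Fits W s ∧ f.Fits W s ∧ f.eval s ≠ 0

/-- Tests. -/
inductive BExp where
  | natLt (e f : NExp)
  | natEq (e f : NExp)
  | realLt (e f : RExp)
  | not (b : BExp)
  | and (b c : BExp)

def BExp.Holds (s : Store) : BExp → Prop
  | .natLt e f => e.eval s < f.eval s
  | .natEq e f => e.eval s = f.eval s
  | .realLt e f => e.eval s < f.eval s
  | .not b => ¬ b.Holds s
  | .and b c => b.Holds s ∧ c.Holds s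

def BExp.cost : BExp → ℕ
  | .natLt e f => e.cost + f.cost + 1
  | .natEq e f => e.cost + f.cost + 1
  | .realLt e f => e.cost + f.cost + 1
  | .not b => b.cost + 1
  | .and b c => b.cost + c.cost + 1

def BExp.Fits (W : ℕ) (s : Store) : BExp → Prop
  | .natLt e f => e.Fits W s ∧ f.Fits W s
  | .natEq e f => e.Fits W s ∧ f.Fits W s
  | .realLt e f => e.Fits W s ∧ f.Fits W s
  | .not b => b.Fits W s
  | .and b c => b.Fits W s ∧ c.Fits W s

/-- Programs. `query r k i a c` asks player `i` for her value of the bundle of all items `j` for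
which cell `j` of the integer array `a` holds `c`, and stores the answer in cell `k` of the real
array `r`. -/
inductive Program where
  | skip
  | setNat (a : ℕ) (k e : NExp)
  | setReal (a : ℕ) (k : NExp) (e : RExp)
  | query (r : ℕ) (k i : NExp) (a : ℕ) (c : NExp)
  | seq (P Q : Program)
  | ite (b : BExp) (P Q : Program)
  | loop (b : BExp) (P : Program)

/-- `Exec W v P s s' t`: with words bounded by `W` and with value queries answered
according to `v`, the program `P`, started on the memory `s`, halts with the memory `s'`
after exactly `t` steps. Besides the evaluation of its expressions every instruction, in
particular every value query, is one step; `loop b P` repeats `P` as long as `b` holds. -/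
inductive Exec {n m : ℕ} (W : ℕ) (v : Fin n → Valuation m) :
    Program → Store → Store → ℕ → Prop where
  | skip (s : Store) : Exec W v .skip s s 1
  | setNat (a : ℕ) (k e : NExp) (s : Store) (hk : k.Fits W s) (he : e.Fits W s) :
      Exec W v (.setNat a k e) s (s.setNat a (k.eval s) (e.eval s)) (k.cost + e.cost + 1)
  | setReal (a : ℕ) (k : NExp) (e : RExp) (s : Store) (hk : k.Fits W s) (he : e.Fits W s) :
      Exec W v (.setReal a k e) s (s.setReal a (k.eval s) (e.eval s)) (k.cost + e.cost + 1)
  | query (r : ℕ) (k i : NExp) (a : ℕ) (c : NExp) (s : Store)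
      (hk : k.Fits W s) (hi : i.Fits W s) (hc : c.Fits W s) (hn : i.eval s < n) :
      Exec W v (.query r k i a c) s
        (s.setReal r (k.eval s)
          ((v ⟨i.eval s, hn⟩).val (Finset.univ.filter fun j : Fin m => s.nat a j = c.eval s)))
        (k.cost + i.cost + c.cost + 1)
  | seq (P Q : Program) (s s' s'' : Store) (t t' : ℕ)
      (hP : Exec W v P s s' t) (hQ : Exec W v Q s' s'' t') :
      Exec W v (.seq P Q) s s'' (t + t')
  | iteTrue (b : BExp) (P Q : Program) (s s' : Store) (t : ℕ) (hf : b.Fits W s)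
      (hb : b.Holds s) (hP : Exec W v P s s' t) :
      Exec W v (.ite b P Q) s s' (b.cost + t + 1)
  | iteFalse (b : BExp) (P Q : Program) (s s' : Store) (t : ℕ) (hf : b.Fits W s)
      (hb : ¬ b.Holds s) (hQ : Exec W v Q s s' t) :
      Exec W v (.ite b P Q) s s' (b.cost + t + 1)
  | loopEnd (b : BExp) (P : Program) (s : Store) (hf : b.Fits W s) (hb : ¬ b.Holds s) :
      Exec W v (.loop b P) s s (b.cost + 1)
  | loopStep (b : BExp) (P : Program) (s s' s'' : Store) (t t' : ℕ) (hf : b.Fits W s)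
      (hb : b.Holds s) (hP : Exec W v P s s' t) (hL : Exec W v (.loop b P) s' s'' t') :
      Exec W v (.loop b P) s s'' (b.cost + t + t' + 1)

/-- The memory at the start: `n` and `m` are in the cells `0` of the integer arrays `0` and `1`,
and all other cells are `0`. -/
def initialStore (n m : ℕ) : Store where
  nat := fun a k => if k = 0 then (if a = 0 then n else if a = 1 then m else 0) else 0
  real := fun _ _ => 0

/-- The program `P` computes the mechanism `M`, allocations and fees, in at most `T` steps with
words bounded by `W`. At the end, cell `j` of the integer array `2` is `i + 1` if item
`j` goes to player `i`, and `0` if it is left over; cell `i` of the real array `0` is the fee of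
player `i`. -/
def Computes {n m : ℕ} (P : Program) (M : Mechanism n m) (W T : ℕ) : Prop :=
  ∀ v : Fin n → Valuation m, ∃ (s : Store) (t : ℕ),
    Exec W v P (initialStore n m) s t ∧ t ≤ T ∧
    (∀ j : Fin m, s.nat 2 j = (M.alloc v j).elim 0 fun i => (i : ℕ) + 1) ∧
    ∀ i : Fin n, s.real 0 i = M.fee v i

end PercentageFee

end

/-!
Let `q` be a prime, and give item `j` to the player in whose part of a partition of `ZMod q` into
`n` intervals the value `w(j)` of a uniformly random polynomial `w` of degree less than `n` lies. By
Lagrange interpolation the values at `n` distinct items are independent and uniform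
(`card_polyValue_mem`), so the owners are `n`-wise independent, and uniform up to an error of
`1 / q` (`kWiseIndependent_sampleDist`, `nearlyUniform_sampleDist`). The mechanism selects the best
of these `q ^ n` assignments. Player `i` keeps the fraction of her value that is the welfare
(product of values) of the others, divided by the highest welfare of the others in the range. Her
profit is therefore the welfare of the selected assignment divided by a number that does not depend
on her report, which is the VCG argument in multiplicative form (`incentiveCompatible_of_isOutcome`).

For the approximation, let an additive function `p i` support the valuation of each player `i` on
her bundle `O i` in an arbitrary allocation. The product over `i` of the sums of `p i` over the part
of `O i` that player `i` receives expands into products over `n` distinct items, whose owners are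
independent; so its expectation is about `n ^ (-n)` times the product of the full sums
(`exists_sample_welfare_ge`). XOS valuations are supported exactly, and subadditive ones up to
a harmonic number, by the prices of a greedy covering (`exists_greedy_prices`).

The time bound leaves only constant time, on average, for each of about `m ^ n` assignments, less
than it takes to write one down. The program therefore runs through the polynomials without constant
term, sorts the items by the value of the polynomial, and lets the constant term run through
`ZMod q`. When the constant grows by one, the items that change hands are those whose value has just
reached the start of an interval. They form `n` of the buckets, and during the whole sweep every item
moves only once to each player (`runs_sweepStep`, `sum_bucketSize_movingValue`). Only the number of
the best polynomial and its constant are stored, and the allocation is rebuilt at the end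
(`runs_finish`). The prime lies between `L` and `2 * L` for `L = n * K + (n - 1) * m`: this is of
order `m` for two or more players, and bounded for a single player, so that trial division and the
enumeration both stay within the bound (`exists_resource_bound`).
-/

namespace PercentageFee

section

/-! ### An `n`-wise independent family of assignments -/

/-- The value at `x` of the polynomial of degree less than `n` with the coefficients `w`. -/
def polyValue {n q : ℕ} (w : Fin n → ZMod q) (x : ZMod q) : ZMod q :=
  ∑ i, w i * x ^ (i : ℕ)

/-- A partition of the residues modulo `q` into `n` intervals of nearly equal length. -/
def owner (n q : ℕ) [NeZero n] [NeZero q] (y : ZMod q) : Fin n :=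
  ⟨y.val * n / q, Nat.div_lt_of_lt_mul
    (Nat.mul_lt_mul_of_pos_right (ZMod.val_lt y) (NeZero.pos n))⟩

/-- The assignment of the items given by a polynomial over `ZMod q`: item `j` goes to the
player in whose interval the value of the polynomial at `j` lies. -/
def sample {n q : ℕ} (m : ℕ) [NeZero n] [NeZero q] (w : Fin n → ZMod q) : Fin m → Fin n :=
  fun j => owner n q (polyValue w ((j : ℕ) : ZMod q))

/-- Evaluation of polynomials at the items of `J`, as a homomorphism of groups. -/
def polyValueHom (n q : ℕ) {m : ℕ} (J : Finset (Fin m)) :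
    (Fin n → ZMod q) →+ (J → ZMod q) where
  toFun w j := polyValue w ((j : Fin m) : ℕ)
  map_zero' := by ext j; simp [polyValue]
  map_add' w w' := by ext j; simp [polyValue, add_mul, Finset.sum_add_distrib]

/-- Lagrange interpolation. -/
theorem polyValueHom_surjective {n q m : ℕ} [Fact q.Prime] {J : Finset (Fin m)}
    (hJ : J.card ≤ n) (hinj : Set.InjOn (fun j : Fin m => ((j : ℕ) : ZMod q)) J) :
    Function.Surjective (polyValueHom n q J) := by
  intro y
  let r : Fin m → ZMod q := fun j => if h : j ∈ J then y ⟨j, h⟩ else 0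
  let p := Lagrange.interpolate J (fun j : Fin m => ((j : ℕ) : ZMod q)) r
  have hdeg : p.degree < n :=
    (Lagrange.degree_interpolate_lt r hinj).trans_le (by exact_mod_cast hJ)
  refine ⟨fun i => p.coeff i, ?_⟩
  ext j
  have h1 : p.eval (((j : Fin m) : ℕ) : ZMod q) = r j :=
    Lagrange.eval_interpolate_at_node r hinj j.2
  have h2 : r j = y j := by simp [r]
  rw [← h2, ← h1]
  change ∑ i : Fin n, p.coeff i * _ ^ (i : ℕ) = _
  rw [Fin.sum_univ_eq_sum_range (fun i => p.coeff i * (((j : Fin m) : ℕ) : ZMod q) ^ i)]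
  by_cases hp : p = 0
  · simp [hp]
  · rw [Polynomial.eval_eq_sum_range' ((Polynomial.natDegree_lt_iff_degree_lt hp).2 hdeg)]

/-- The values of a random polynomial at up to `n` items are independent and uniform. -/
theorem card_polyValue_mem {n q m : ℕ} [Fact q.Prime] {J : Finset (Fin m)}
    (hJ : J.card ≤ n) (hinj : Set.InjOn (fun j : Fin m => ((j : ℕ) : ZMod q)) J)
    (A : Fin m → Finset (ZMod q)) :
    (Finset.univ.filter fun w : Fin n → ZMod q =>
        ∀ j ∈ J, polyValue w ((j : ℕ) : ZMod q) ∈ A j).card * q ^ J.card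
      = q ^ n * ∏ j ∈ J, (A j).card := by
  classical
  have hsurj := polyValueHom_surjective hJ hinj
  set f := polyValueHom n q J with hf
  have hfib : ∀ y, (Finset.univ.filter fun w => f w = y).card
      = (Finset.univ.filter fun w => f w = 0).card := fun y =>
    AddMonoidHom.card_fiber_eq_of_mem_range f (hsurj y) (hsurj 0)
  set k := (Finset.univ.filter fun w => f w = 0).card with hk
  have htot : q ^ n = k * q ^ J.card := by
    have h := Finset.card_eq_sum_card_fiberwise (f := f) (s := Finset.univ) (t := Finset.univ)
      (fun _ _ => Finset.mem_coe.2 (Finset.mem_univ _))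
    simp only [hfib] at h
    simpa [ZMod.card, mul_comm] using h
  have hcount : (Finset.univ.filter fun w : Fin n → ZMod q =>
      ∀ j ∈ J, polyValue w ((j : ℕ) : ZMod q) ∈ A j).card = (∏ j ∈ J, (A j).card) * k := by
    have h := Finset.card_eq_sum_card_fiberwise (f := f)
      (s := Finset.univ.filter fun w : Fin n → ZMod q =>
        ∀ j ∈ J, polyValue w ((j : ℕ) : ZMod q) ∈ A j)
      (t := Fintype.piFinset fun j : J => A j) (by
        intro w hw
        simp only [Finset.coe_filter, Finset.mem_univ, true_and, Set.mem_ofPred_eq] at hw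
        simp only [Finset.mem_coe, Fintype.mem_piFinset]
        exact fun j => hw j j.2)
    rw [h, Finset.sum_congr rfl (g := fun _ => k), Finset.sum_const, Fintype.card_piFinset,
      smul_eq_mul, Finset.prod_coe_sort J (fun j => (A j).card)]
    intro y hy
    rw [← hfib y, Finset.filter_filter]
    congr 1
    ext w
    simp only [Finset.mem_filter, Finset.mem_univ, true_and, and_iff_right_iff_imp]
    rintro rfl j hj
    exact Fintype.mem_piFinset.1 hy ⟨j, hj⟩
  rw [hcount, htot]
  ring

/-- The owners of up to `n` items are independent: the probabilities multiply. -/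
theorem card_owner_mem {n q m : ℕ} [NeZero n] [Fact q.Prime] {J : Finset (Fin m)}
    (hJ : J.card ≤ n) (hinj : Set.InjOn (fun j : Fin m => ((j : ℕ) : ZMod q)) J)
    (A : Fin m → Set (Fin n)) [∀ j, DecidablePred (· ∈ A j)] :
    ((Finset.univ.filter fun w : Fin n → ZMod q => ∀ j ∈ J, sample m w j ∈ A j).card : ℝ)
      = q ^ n * ∏ j ∈ J, (((Finset.univ.filter fun y => owner n q y ∈ A j).card : ℝ) / q) := by
  have h := card_polyValue_mem hJ hinj (fun j => Finset.univ.filter fun y => owner n q y ∈ A j)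
  simp only [Finset.mem_filter, Finset.mem_univ, true_and] at h
  have hq : (q : ℝ) ≠ 0 := by exact_mod_cast (Fact.out : q.Prime).ne_zero
  rw [Finset.prod_div_distrib, Finset.prod_const, ← mul_div_assoc, eq_div_iff (by positivity)]
  exact_mod_cast h

/-- The first residue of the interval of player `i`, which is `i * q / n` rounded up. -/
def firstResidue (n q i : ℕ) : ℕ := (i * q + (n - 1)) / n

/-- Rounding up is adjoint to rounding down. -/
theorem le_firstResidue_iff {n q i x : ℕ} (hn : 0 < n) :
    firstResidue n q i ≤ x ↔ i ≤ x * n / q ∨ q = 0 := by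
  rcases Nat.eq_zero_or_pos q with rfl | hq
  · simp only [firstResidue, mul_zero, zero_add, or_true, iff_true]
    rw [Nat.div_eq_of_lt (by omega)]
    exact Nat.zero_le _
  · rw [firstResidue, Nat.le_div_iff_mul_le hq, ← Nat.lt_add_one_iff, Nat.div_lt_iff_lt_mul hn,
      add_mul, one_mul]
    omega

theorem card_owner_eq {n q : ℕ} [NeZero n] [NeZero q] (i : Fin n) :
    (Finset.univ.filter fun y => owner n q y = i).card
      = firstResidue n q (i + 1) - firstResidue n q i := by
  have hn := NeZero.pos n
  have hq := NeZero.pos q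
  rw [← Nat.card_Ico]
  refine Finset.card_nbij (fun y => y.val) ?_ (fun y _ z _ h => ZMod.val_injective q h) ?_
  · intro y hy
    simp only [owner, Finset.coe_filter, Finset.mem_univ, true_and, Set.mem_ofPred_eq,
      Fin.ext_iff] at hy
    rw [Finset.mem_coe, Finset.mem_Ico, ← not_le, le_firstResidue_iff hn, le_firstResidue_iff hn]
    dsimp only
    omega
  · intro x hx
    rw [Finset.mem_coe, Finset.mem_Ico, ← not_le, le_firstResidue_iff hn,
      le_firstResidue_iff hn] at hx
    have hx' : x * n / q = i := by omega
    have hxq : x < q := by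
      by_contra hge
      have : n ≤ x * n / q := by
        rw [Nat.le_div_iff_mul_le hq, mul_comm]
        exact Nat.mul_le_mul_right _ (not_lt.1 hge)
      have := i.2
      omega
    refine ⟨(x : ZMod q), ?_, ZMod.val_cast_of_lt hxq⟩
    simp [owner, Fin.ext_iff, ZMod.val_cast_of_lt hxq, hx']

theorem firstResidue_bounds {n q i : ℕ} (hn : 0 < n) :
    (i * q / n : ℝ) ≤ firstResidue n q i ∧ (firstResidue n q i : ℝ) ≤ i * q / n + 1 - 1 / n := by
  have hn' : (0 : ℝ) < n := by exact_mod_cast hn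
  have h1 : firstResidue n q i * n ≤ i * q + (n - 1) := Nat.div_mul_le_self _ _
  have h2 : i * q ≤ firstResidue n q i * n := by
    have := Nat.lt_div_mul_add (a := i * q + (n - 1)) hn
    rw [firstResidue]
    omega
  have h1' : (firstResidue n q i * n : ℝ) ≤ i * q + (n - 1) := by
    have : ((n - 1 : ℕ) : ℝ) = n - 1 := by rw [Nat.cast_sub hn]; simp
    rw [← this]; exact_mod_cast h1
  constructor
  · rw [div_le_iff₀ hn']; exact_mod_cast h2
  · have : (i * q / n + 1 - 1 / n : ℝ) = (i * q + (n - 1)) / n := by field_simp; ring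
    rw [this, le_div_iff₀ hn']; exact h1'

theorem card_owner_eq_bounds {n q : ℕ} [NeZero n] [NeZero q] (i : Fin n) :
    |((Finset.univ.filter fun y => owner n q y = i).card : ℝ) / q - 1 / n| ≤ 1 / q := by
  have hn := NeZero.pos n
  have hq : (0 : ℝ) < q := by exact_mod_cast NeZero.pos q
  have hn' : (0 : ℝ) < n := by exact_mod_cast hn
  obtain ⟨h1, h2⟩ := firstResidue_bounds (q := q) (i := i) hn
  obtain ⟨h3, h4⟩ := firstResidue_bounds (q := q) (i := i + 1) hn
  have hle : firstResidue n q i ≤ firstResidue n q (i + 1) :=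
    Nat.div_le_div_right (by gcongr; omega)
  rw [card_owner_eq, Nat.cast_sub hle]
  have e : ∀ x : ℝ, x / q - 1 / n = (x - q / n) / q := fun x => by field_simp
  rw [e, abs_div, abs_of_pos hq]
  gcongr
  have h5 : (0 : ℝ) < 1 / n := by positivity
  have h6 : (((i : ℕ) + 1 : ℕ) * q / n : ℝ) = (i : ℕ) * q / n + q / n := by push_cast; ring
  rw [h6] at h3 h4
  rw [abs_le]
  constructor <;> linarith

/-- The distribution of the assignment given by a uniformly random polynomial. -/
noncomputable def sampleDist (n m q : ℕ) [NeZero n] [NeZero q] : PMF (Fin m → Fin n) :=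
  (PMF.uniformOfFintype (Fin n → ZMod q)).map (sample m)

theorem support_sampleDist (n m q : ℕ) [NeZero n] [NeZero q] :
    (sampleDist n m q).support = Set.range (sample (n := n) (q := q) m) := by
  simp [sampleDist, PMF.support_map]

open Classical in
theorem sampleDist_apply {n m q : ℕ} [NeZero n] [NeZero q] (A : Set (Fin m → Fin n)) :
    (sampleDist n m q).toMeasure A
      = ENNReal.ofReal ((Finset.univ.filter fun w : Fin n → ZMod q => sample m w ∈ A).card
          / (q : ℝ) ^ n) := by
  let _ : MeasurableSpace (Fin n → ZMod q) := ⊤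
  have hq : (0 : ℝ) < q := by exact_mod_cast NeZero.pos q
  rw [sampleDist, PMF.toMeasure_map_apply _ _ _ (measurable_from_top)
    (Set.Finite.measurableSet (Set.toFinite A)),
    PMF.toMeasure_uniformOfFintype_apply _ MeasurableSpace.measurableSet_top,
    ENNReal.ofReal_div_of_pos (by positivity), ENNReal.ofReal_natCast,
    ENNReal.ofReal_pow hq.le, ENNReal.ofReal_natCast]
  congr 1
  · rw [Fintype.card_subtype]
    rfl
  · simp [ZMod.card]

theorem kWiseIndependent_sampleDist {n m q : ℕ} [NeZero n] [Fact q.Prime]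
    (hinj : ∀ J : Finset (Fin m), J.card ≤ n →
      Set.InjOn (fun j : Fin m => ((j : ℕ) : ZMod q)) J) :
    KWiseIndependent n (sampleDist n m q) := by
  classical
  intro J hJ
  have hq : (q : ℝ) ≠ 0 := by exact_mod_cast (Fact.out : q.Prime).ne_zero
  rw [iIndepFun_iff_measure_inter_preimage_eq_mul]
  intro S A _
  have key : ∀ S : Finset J,
      (sampleDist n m q).toMeasure
        (⋂ i ∈ S, (fun g : Fin m → Fin n => g (i : Fin m)) ⁻¹' A i) =
      ENNReal.ofReal (∏ i ∈ S,
        (((Finset.univ.filter fun y => owner n q y ∈ A i).card : ℝ) / q)) := by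
    intro S
    set J' := S.map (Function.Embedding.subtype (· ∈ J)) with hJ'
    have hcard : J'.card ≤ n := by
      rw [hJ', Finset.card_map]
      exact (Finset.card_le_univ S).trans (by simpa using hJ)
    let A' : Fin m → Set (Fin n) := fun j => if h : j ∈ J then A ⟨j, h⟩ else Set.univ
    have hA' : ∀ i : J, A' i = A i := fun i => by simp [A']
    have h := card_owner_mem hcard (hinj J' hcard) A'
    rw [sampleDist_apply]
    congr 1
    have e1 : (Finset.univ.filter fun w : Fin n → ZMod q => sample m w ∈
        (⋂ i ∈ S, (fun g : Fin m → Fin n => g (i : Fin m)) ⁻¹' A i))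
        = Finset.univ.filter fun w : Fin n → ZMod q => ∀ j ∈ J', sample m w j ∈ A' j := by
      ext w
      simp only [Finset.mem_filter, Finset.mem_univ, true_and, Set.mem_iInter, Set.mem_preimage,
        hJ', Finset.mem_map, forall_exists_index, and_imp]
      constructor
      · rintro h j i hi rfl
        change _ ∈ A' i
        rw [hA']
        exact h i hi
      · intro h i hi
        have := h i i hi rfl
        rwa [hA'] at this
    rw [e1, h, hJ', Finset.prod_map, mul_div_cancel_left₀ _ (pow_ne_zero _ hq)]
    refine Finset.prod_congr rfl fun i _ => ?_
    change ((Finset.univ.filter fun y => owner n q y ∈ A' i).card : ℝ) / q = _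
    simp only [hA']
  rw [key S, ENNReal.ofReal_prod_of_nonneg (fun _ _ => by positivity)]
  refine Finset.prod_congr rfl fun i _ => ?_
  have := key {i}
  simp only [Finset.mem_singleton, Set.iInter_iInter_eq_left, Finset.prod_singleton] at this
  rw [this]

theorem nearlyUniform_sampleDist {n m q : ℕ} [NeZero n] [Fact q.Prime] {ε : ℝ}
    (hε : n ≤ ε * q) : NearlyUniform ε (sampleDist n m q) := by
  classical
  intro j i
  have hq : (0 : ℝ) < q := by exact_mod_cast (Fact.out : q.Prime).pos
  have hn : (0 : ℝ) < n := by exact_mod_cast NeZero.pos n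
  have h := card_owner_mem (n := n) (q := q) (J := {j})
    (by simpa using NeZero.one_le) (by simp) (fun _ => {i})
  simp only [Finset.mem_singleton, forall_eq, Set.mem_singleton_iff, Finset.prod_singleton] at h
  rw [measureReal_def, sampleDist_apply, ENNReal.toReal_ofReal (by positivity)]
  simp only [Set.mem_ofPred_eq]
  rw [h, mul_div_cancel_left₀ _ (by positivity)]
  refine (card_owner_eq_bounds i).trans ?_
  rw [div_le_div_iff₀ hq hn]
  linarith

/-- Distinct items stay distinct modulo `q` whenever this matters: among at most one item there
is nothing to separate, so that `q` need not grow with `m` for a single player. -/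
theorem injOn_items {n m q : ℕ} (hq : (n - 1) * m ≤ q) {J : Finset (Fin m)} (hJ : J.card ≤ n) :
    Set.InjOn (fun j : Fin m => ((j : ℕ) : ZMod q)) J := by
  intro a ha b hb hab
  by_contra hne
  have h2 : 2 ≤ J.card := Finset.one_lt_card.2 ⟨a, ha, b, hb, hne⟩
  have hmq : m ≤ q := le_trans (Nat.le_mul_of_pos_left m (by omega)) hq
  have := (ZMod.natCast_eq_natCast_iff' _ _ _).1 hab
  rw [Nat.mod_eq_of_lt (a.2.trans_le hmq), Nat.mod_eq_of_lt (b.2.trans_le hmq)] at this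
  exact hne (Fin.ext this)

end

section

/-! ### Valuations supported by additive functions -/

theorem Valuation.nonneg {m : ℕ} (v : Valuation m) (S : Finset (Fin m)) : 0 ≤ v.val S :=
  v.empty ▸ v.mono ∅ S (Finset.empty_subset S)

/-- On every bundle `O`, some non-negative additive function stays below `v` on all subsets
of `O` and reaches a fraction `1 / β` of `v` on `O` itself. -/
def Valuation.IsSupported {m : ℕ} (v : Valuation m) (β : ℝ) : Prop :=
  ∀ O : Finset (Fin m), ∃ a : Fin m → ℝ, (∀ j ∈ O, 0 ≤ a j) ∧
    (∀ S ⊆ O, ∑ j ∈ S, a j ≤ v.val S) ∧ v.val O ≤ β * ∑ j ∈ O, a j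

theorem Valuation.IsXOS.isSupported {m : ℕ} {v : Valuation m} (hv : v.IsXOS) :
    v.IsSupported 1 := by
  obtain ⟨t, a, ha⟩ := hv
  intro O
  obtain ⟨l, hl⟩ := (ha O).1
  -- Monotonicity of `v` allows negative coefficients to be replaced by zero.
  refine ⟨fun j => max (a l j) 0, fun j _ => le_max_right _ _, fun S _ => ?_, ?_⟩
  · have h1 : ∑ j ∈ S, max (a l j) 0 = ∑ j ∈ S.filter (fun j => 0 ≤ a l j), a l j := by
      rw [Finset.sum_filter]
      refine Finset.sum_congr rfl fun j _ => ?_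
      split_ifs with h
      · exact max_eq_left h
      · exact max_eq_right (not_le.1 h).le
    rw [h1]
    exact ((ha _).2 ⟨l, rfl⟩).trans (v.mono _ _ (Finset.filter_subset _ _))
  · rw [one_mul, ← hl]
    exact Finset.sum_le_sum fun j _ => le_max_left _ _

/-- Each of the `b` terms added to the harmonic sum is at least `1 / (a + b)`. -/
theorem harmonic_add_div_le (a b : ℕ) :
    (harmonic a : ℝ) + b / (a + b : ℕ) ≤ harmonic (a + b) := by
  have key : ∀ k ≤ b, (harmonic a : ℝ) + k / (a + b : ℕ) ≤ harmonic (a + k) := by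
    intro k
    induction k with
    | zero => simp
    | succ k ih =>
      intro hk
      have h1 := ih (by omega)
      rw [← add_assoc, harmonic_succ]
      have h2 : (1 / ((a + b : ℕ) : ℝ)) ≤ 1 / ((a + k + 1 : ℕ) : ℝ) :=
        one_div_le_one_div_of_le (by positivity) (by exact_mod_cast (by omega))
      push_cast at h1 h2 ⊢
      rw [add_div]
      rw [one_div ((a : ℝ) + k + 1)] at h2
      linarith
  exact key b le_rfl

/-- The greedy covering of `U` by bundles of least average value: each item pays the average
value of the bundle that covers it first. These prices cover `v U`, and a bundle `S` is overcharged
at most by the harmonic number of its size. -/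
theorem exists_greedy_prices {m : ℕ} {v : Valuation m} (hv : v.IsSubadditive)
    (U : Finset (Fin m)) :
    ∃ p : Fin m → ℝ, (∀ j ∈ U, 0 ≤ p j) ∧ v.val U ≤ ∑ j ∈ U, p j ∧
      ∀ S ⊆ U, ∑ j ∈ S, p j ≤ harmonic S.card * v.val S := by
  induction U using Finset.strongInduction with
  | H U ih =>
    rcases U.eq_empty_or_nonempty with rfl | hU
    · refine ⟨0, by simp, by simp [v.empty], fun S hS => ?_⟩
      rw [Finset.subset_empty.1 hS]
      simp
    · obtain ⟨T, hT, hmin⟩ := Finset.exists_min_image (U.powerset.erase ∅)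
        (fun T => v.val T / T.card) ⟨U, by simp [hU.ne_empty]⟩
      simp only [Finset.mem_erase, Finset.mem_powerset, ne_eq] at hT hmin
      obtain ⟨hT0, hTU⟩ := hT
      have hTne := Finset.nonempty_iff_ne_empty.2 hT0
      have hTc : (0 : ℝ) < T.card := by exact_mod_cast hTne.card_pos
      obtain ⟨p, hp0, hpU, hpS⟩ := ih (U \ T) (Finset.sdiff_ssubset hTU hTne)
      have hsum : ∀ S : Finset (Fin m), ∑ j ∈ S, (if j ∈ T then v.val T / T.card else p j)
          = (S ∩ T).card * (v.val T / T.card) + ∑ j ∈ S \ T, p j := by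
        intro S
        rw [Finset.sum_ite, Finset.sum_const, nsmul_eq_mul, Finset.filter_mem_eq_inter,
          Finset.filter_notMem_eq_sdiff]
      refine ⟨fun j => if j ∈ T then v.val T / T.card else p j, fun j hj => ?_, ?_, ?_⟩
      · dsimp only
        split_ifs with h
        · exact div_nonneg (v.nonneg T) hTc.le
        · exact hp0 j (Finset.mem_sdiff.2 ⟨hj, h⟩)
      · rw [hsum, Finset.inter_eq_right.2 hTU, mul_div_cancel₀ _ hTc.ne']
        have := hv T (U \ T)
        rw [Finset.union_sdiff_of_subset hTU] at this
        linarith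
      · intro S hSU
        rcases S.eq_empty_or_nonempty with rfl | hS
        · simp
        have hSc : (0 : ℝ) < S.card := by exact_mod_cast hS.card_pos
        rw [hsum]
        have h1 : v.val T / T.card ≤ v.val S / S.card := hmin S ⟨hS.ne_empty, hSU⟩
        have h2 : ∑ j ∈ S \ T, p j ≤ harmonic (S \ T).card * v.val S :=
          (hpS _ (Finset.sdiff_subset_sdiff hSU le_rfl)).trans
            (mul_le_mul_of_nonneg_left (v.mono _ _ Finset.sdiff_subset)
              (by exact_mod_cast (by unfold harmonic; positivity : 0 ≤ harmonic (S \ T).card)))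
        have h3 := harmonic_add_div_le (S \ T).card (S ∩ T).card
        rw [Finset.card_sdiff_add_card_inter] at h3
        calc ((S ∩ T).card : ℝ) * (v.val T / T.card) + ∑ j ∈ S \ T, p j
            ≤ (S ∩ T).card * (v.val S / S.card) + harmonic (S \ T).card * v.val S := by gcongr
          _ = (harmonic (S \ T).card + (S ∩ T).card / S.card) * v.val S := by ring
          _ ≤ _ := mul_le_mul_of_nonneg_right h3 (v.nonneg S)

theorem harmonic_mono {a b : ℕ} (h : a ≤ b) : (harmonic a : ℝ) ≤ harmonic b := by
  obtain ⟨c, rfl⟩ := Nat.exists_eq_add_of_le h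
  have := harmonic_add_div_le a c
  have h2 : (0 : ℝ) ≤ c / (a + c : ℕ) := by positivity
  linarith

theorem Valuation.IsSubadditive.isSupported {m : ℕ} {v : Valuation m} (hv : v.IsSubadditive)
    (hm : 1 ≤ m) : v.IsSupported (harmonic m) := by
  intro O
  obtain ⟨p, hp0, hpU, hpS⟩ := exists_greedy_prices hv O
  have hpos : (0 : ℝ) < harmonic m := by exact_mod_cast harmonic_pos (by omega)
  refine ⟨fun j => p j / harmonic m, fun j hj => div_nonneg (hp0 j hj) hpos.le,
    fun S hS => ?_, ?_⟩
  · rw [← Finset.sum_div, div_le_iff₀ hpos, mul_comm]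
    refine (hpS S hS).trans (mul_le_mul_of_nonneg_right (harmonic_mono ?_) (v.nonneg S))
    simpa using Finset.card_le_univ S
  · rw [← Finset.sum_div, mul_div_cancel₀ _ hpos.ne']
    exact hpU

/-! ### A random assignment retains a fraction of the welfare -/

/-- The product of the values of all players. -/
def welfare {n m : ℕ} (v : Fin n → Valuation m) (a : Allocation n m) : ℝ :=
  ∏ i, (v i).val (bundle a i)

/-- The product of the values of all players other than `i`. -/
def othersWelfare {n m : ℕ} (v : Fin n → Valuation m) (i : Fin n) (a : Allocation n m) : ℝ :=
  ∏ l ∈ Finset.univ.erase i, (v l).val (bundle a l)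

/-- The allocation that assigns all items as prescribed by `g`. -/
def full {n m : ℕ} (g : Fin m → Fin n) : Allocation n m := fun j => some (g j)

theorem welfare_nonneg {n m : ℕ} (v : Fin n → Valuation m) (a : Allocation n m) :
    0 ≤ welfare v a := Finset.prod_nonneg fun i _ => (v i).nonneg _

theorem othersWelfare_mul {n m : ℕ} (v : Fin n → Valuation m) (i : Fin n)
    (a : Allocation n m) : othersWelfare v i a * (v i).val (bundle a i) = welfare v a :=
  Finset.prod_erase_mul _ _ (Finset.mem_univ i)

theorem mem_bundle {n m : ℕ} {a : Allocation n m} {i : Fin n} {j : Fin m} :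
    j ∈ bundle a i ↔ a j = some i := by simp [bundle]

/-- A product of one item for each player, taken from disjoint bundles, involves `n` distinct
items, whose owners are independent; so the expected welfare is bounded from below term by term. -/
theorem exists_sample_welfare_ge {n m q : ℕ} [NeZero n] [Fact q.Prime] {δ : ℝ} (hδ : n ≤ δ * q)
    (hδ1 : δ ≤ 1)
    (hinj : ∀ J : Finset (Fin m), J.card ≤ n →
      Set.InjOn (fun j : Fin m => ((j : ℕ) : ZMod q)) J)
    (v : Fin n → Valuation m) (a : Allocation n m) (p : Fin n → Fin m → ℝ)
    (hp0 : ∀ i, ∀ j ∈ bundle a i, 0 ≤ p i j)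
    (hp : ∀ i, ∀ S ⊆ bundle a i, ∑ j ∈ S, p i j ≤ (v i).val S) :
    ∃ w : Fin n → ZMod q,
      ((1 - δ) / n) ^ n * ∏ i, ∑ j ∈ bundle a i, p i j ≤ welfare v (full (sample m w)) := by
  classical
  have hq : (0 : ℝ) < q := by exact_mod_cast (Fact.out : q.Prime).pos
  have hn : (0 : ℝ) < n := by exact_mod_cast NeZero.pos n
  have hstep : ∀ w : Fin n → ZMod q,
      ∏ i, ∑ j ∈ bundle a i, (if sample m w j = i then p i j else 0)
        ≤ welfare v (full (sample m w)) := by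
    intro w
    refine Finset.prod_le_prod (fun i _ => Finset.sum_nonneg fun j hj => ?_) fun i _ => ?_
    · split_ifs
      exacts [hp0 i j hj, le_rfl]
    · rw [← Finset.sum_filter]
      refine (hp i _ (Finset.filter_subset _ _)).trans ((v i).mono _ _ fun j hj => ?_)
      rw [mem_bundle, full, (Finset.mem_filter.1 hj).2]
  have hprob : ∀ φ ∈ Fintype.piFinset fun i => bundle a i,
      (q : ℝ) ^ n * ((1 - δ) / n) ^ n
        ≤ (Finset.univ.filter fun w : Fin n → ZMod q => ∀ i, sample m w (φ i) = i).card := by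
    intro φ hφ
    rw [Fintype.mem_piFinset] at hφ
    have hφinj : Function.Injective φ := by
      intro i i' h
      have h1 := mem_bundle.1 (hφ i)
      rw [h, mem_bundle.1 (hφ i')] at h1
      exact (Option.some.inj h1).symm
    have hJ : (Finset.univ.image φ).card ≤ n := by
      simpa using Finset.card_image_le (s := Finset.univ) (f := φ)
    have h := card_owner_mem hJ (hinj _ hJ) (fun j => {i | φ i = j})
    simp only [Finset.mem_image, Finset.mem_univ, true_and, forall_exists_index,
      forall_apply_eq_imp_iff, Set.mem_ofPred_eq, hφinj.eq_iff] at h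
    rw [h, Finset.prod_image (fun _ _ _ _ h => hφinj h)]
    gcongr
    have e : ((1 - δ) / n) ^ n = ∏ _i : Fin n, (1 - δ) / n := by simp [div_pow]
    rw [e]
    refine Finset.prod_le_prod
      (fun i _ => div_nonneg (by linarith) (by positivity)) fun i _ => ?_
    have hb := (abs_le.1 (card_owner_eq_bounds (n := n) (q := q) i)).1
    have h1 : 1 / (q : ℝ) ≤ δ / n := by rw [div_le_div_iff₀ hq hn]; linarith
    simp only [hφinj.eq_iff, sub_div]
    linarith
  have htotal : (q : ℝ) ^ n * (((1 - δ) / n) ^ n * ∏ i, ∑ j ∈ bundle a i, p i j)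
      ≤ ∑ w : Fin n → ZMod q, welfare v (full (sample m w)) := by
    refine le_trans ?_ (Finset.sum_le_sum fun w _ => hstep w)
    simp only [Finset.prod_univ_sum]
    rw [Finset.sum_comm, ← mul_assoc, Finset.mul_sum]
    refine Finset.sum_le_sum fun φ hφ => ?_
    have e : ∀ w : Fin n → ZMod q,
        ∏ i, (if sample m w (φ i) = i then p i (φ i) else 0)
          = if ∀ i, sample m w (φ i) = i then ∏ i, p i (φ i) else 0 := by
      intro w
      split_ifs with h
      · exact Finset.prod_congr rfl fun i _ => if_pos (h i)
      · push Not at h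
        obtain ⟨i, hi⟩ := h
        exact Finset.prod_eq_zero (Finset.mem_univ i) (if_neg hi)
    simp only [e]
    rw [← Finset.sum_filter, Finset.sum_const, nsmul_eq_mul]
    exact mul_le_mul_of_nonneg_right (hprob φ hφ)
      (Finset.prod_nonneg fun i _ => hp0 i _ (Fintype.mem_piFinset.1 hφ i))
  by_contra! hcon
  have := Finset.sum_lt_sum_of_nonempty (s := (Finset.univ : Finset (Fin n → ZMod q)))
    Finset.univ_nonempty fun w _ => hcon w
  rw [Finset.sum_const, nsmul_eq_mul] at this
  simp only [Finset.card_univ, Fintype.card_fun, ZMod.card, Fintype.card_fin,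
    Nat.cast_pow] at this
  linarith

/-! ### The mechanism -/

/-- The outcome `a` with the fees `p` is what the mechanism may select on the profile `v`: an
assignment in `R` of highest welfare, for which player `i` keeps the fraction of her value that
is the ratio of the welfare of the others to the highest welfare of the others in `R`; and no
allocation and no fees when all the welfare in `R` is zero. -/
def IsOutcome {n m : ℕ} (R : Set (Fin m → Fin n)) (v : Fin n → Valuation m)
    (a : Allocation n m) (p : Fin n → ℝ) : Prop :=
  (∃ g ∈ R, (∀ g' ∈ R, welfare v (full g') ≤ welfare v (full g)) ∧ 0 < welfare v (full g) ∧
    a = full g ∧ ∀ i, ∃ B, IsGreatest ((fun g => othersWelfare v i (full g)) '' R) B ∧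
      p i = 1 - othersWelfare v i (full g) / B) ∨
  ((∀ g ∈ R, welfare v (full g) ≤ 0) ∧ a = nullAllocation n m ∧ ∀ i, p i = 0)

variable {n m : ℕ} {R : Set (Fin m → Fin n)} {M : Mechanism n m}

theorem othersWelfare_pos {v : Fin n → Valuation m} {a : Allocation n m} (h : 0 < welfare v a)
    (i : Fin n) : 0 < othersWelfare v i a := by
  rw [← othersWelfare_mul v i] at h
  exact pos_of_mul_pos_left h ((v i).nonneg _)

theorem feesInRange_of_isOutcome (hM : ∀ v, IsOutcome R v (M.alloc v) (M.fee v)) :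
    M.FeesInRange := by
  intro v i
  rcases hM v with ⟨g, hg, -, hpos, -, hfee⟩ | ⟨-, -, hfee⟩
  · obtain ⟨B, hB, hB'⟩ := hfee i
    have h1 : othersWelfare v i (full g) ≤ B := hB.2 ⟨g, hg, rfl⟩
    have h2 := othersWelfare_pos hpos i
    have h3 : 0 < B := h2.trans_le h1
    rw [hB']
    exact ⟨by linarith [(div_le_one h3).2 h1], by linarith [div_pos h2 h3]⟩
  · simp [hfee]

theorem bundle_nullAllocation (i : Fin n) : bundle (nullAllocation n m) i = ∅ := by
  simp [bundle, nullAllocation]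

theorem othersWelfare_update (v : Fin n → Valuation m) (i : Fin n) (u : Valuation m)
    (a : Allocation n m) : othersWelfare (Function.update v i u) i a = othersWelfare v i a :=
  Finset.prod_congr rfl fun l hl => by
    rw [Function.update_of_ne (Finset.ne_of_mem_erase hl)]

/-- Whatever a player reports, her profit is the true welfare of the selected allocation, divided
by a number that does not depend on her report. -/
theorem incentiveCompatible_of_isOutcome (hM : ∀ v, IsOutcome R v (M.alloc v) (M.fee v)) :
    M.IncentiveCompatible := by
  intro v i u
  have hrange := feesInRange_of_isOutcome hM
  have hnonneg : 0 ≤ M.profit i (v i) v :=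
    mul_nonneg (by linarith [(hrange v i).2]) ((v i).nonneg _)
  rcases hM (Function.update v i u) with ⟨g, hg, -, hpos, ha, hfee⟩ | ⟨-, ha, hfee⟩
  · obtain ⟨B, hB, hB'⟩ := hfee i
    simp only [othersWelfare_update] at hB hB'
    have hB0 : 0 < B := by
      have h1 : othersWelfare v i (full g) ≤ B := hB.2 ⟨g, hg, rfl⟩
      have h2 := othersWelfare_pos hpos i
      rw [othersWelfare_update] at h2
      linarith
    have hdev : M.profit i (v i) (Function.update v i u) = welfare v (full g) / B := by
      rw [Mechanism.profit, hB', ha, ← othersWelfare_mul v i]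
      ring
    rw [hdev]
    rcases hM v with ⟨g', -, hmax, -, ha', hfee'⟩ | ⟨hzero, -, -⟩
    · obtain ⟨B', hBB, hB''⟩ := hfee' i
      rw [Mechanism.profit, hB'', ha', hBB.unique hB, sub_sub_cancel, div_mul_eq_mul_div,
        othersWelfare_mul]
      exact div_le_div_of_nonneg_right (hmax g hg) hB0.le
    · exact (div_nonpos_of_nonpos_of_nonneg (hzero g hg) hB0.le).trans hnonneg
  · rw [Mechanism.profit, ha, bundle_nullAllocation, (v i).empty, mul_zero]
    exact hnonneg

theorem nsw_eq (v : Fin n → Valuation m) (a : Allocation n m) :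
    nsw v a = welfare v a ^ (1 / (n : ℝ)) := rfl

theorem nsw_le_of_welfare_le {v : Fin n → Valuation m} {a b : Allocation n m}
    (h : welfare v a ≤ welfare v b) : nsw v a ≤ nsw v b :=
  Real.rpow_le_rpow (welfare_nonneg v a) h (by positivity)

theorem welfare_nullAllocation [NeZero n] (v : Fin n → Valuation m) :
    welfare v (nullAllocation n m) = 0 :=
  Finset.prod_eq_zero (Finset.mem_univ 0) (by rw [bundle_nullAllocation, (v 0).empty])

theorem welfare_le_of_isOutcome {v : Fin n → Valuation m} {a : Allocation n m} {p : Fin n → ℝ}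
    (h : IsOutcome R v a p) {g : Fin m → Fin n} (hg : g ∈ R) :
    welfare v (full g) ≤ welfare v a := by
  rcases h with ⟨g', -, hmax, -, rfl, -⟩ | ⟨hzero, -, -⟩
  · exact hmax g hg
  · exact (hzero g hg).trans (welfare_nonneg v a)

theorem maximalInRange_of_isOutcome [NeZero n] {D : PMF (Fin m → Fin n)}
    (hM : ∀ v, IsOutcome D.support v (M.alloc v) (M.fee v)) :
    M.MaximalInRange (supportRange D) := by
  intro v
  constructor
  · rcases hM v with ⟨g, hg, -, -, ha, -⟩ | ⟨-, ha, -⟩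
    · exact ha ▸ Or.inr ⟨g, hg, rfl⟩
    · exact ha ▸ Or.inl rfl
  · rintro a (rfl | ⟨g, hg, rfl⟩)
    · exact nsw_le_of_welfare_le ((welfare_nullAllocation v).trans_le (welfare_nonneg v _))
    · exact nsw_le_of_welfare_le (welfare_le_of_isOutcome (hM v) hg)

/-- Some assignment of the range does at least as well as the average one. -/
theorem approximatesNSW_of_isSupported {q : ℕ} [NeZero n] [Fact q.Prime] {δ β : ℝ}
    (hδ : n ≤ δ * q) (hδ1 : δ < 1) (hβ : 0 ≤ β)
    (hinj : ∀ J : Finset (Fin m), J.card ≤ n →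
      Set.InjOn (fun j : Fin m => ((j : ℕ) : ZMod q)) J)
    (v : Fin n → Valuation m) (hv : ∀ i, (v i).IsSupported β)
    (hM : IsOutcome (Set.range (sample (n := n) (q := q) m)) v (M.alloc v) (M.fee v)) :
    M.ApproximatesNSW (β * n / (1 - δ)) v := by
  intro a
  have hn : (0 : ℝ) < n := by exact_mod_cast NeZero.pos n
  have hδ' : 0 < 1 - δ := by linarith
  choose p hp0 hp hpO using fun i => hv i (bundle a i)
  obtain ⟨w, hw⟩ := exists_sample_welfare_ge hδ hδ1.le hinj v a p hp0 hp
  have h1 := hw.trans (welfare_le_of_isOutcome hM ⟨w, rfl⟩)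
  have h2 : welfare v a ≤ β ^ n * ∏ i, ∑ j ∈ bundle a i, p i j := by
    calc welfare v a ≤ ∏ i, (β * ∑ j ∈ bundle a i, p i j) :=
          Finset.prod_le_prod (fun i _ => (v i).nonneg _) fun i _ => hpO i
      _ = _ := by rw [Finset.prod_mul_distrib, Finset.prod_const, Finset.card_fin]
  have h3 : welfare v a ≤ (β * n / (1 - δ)) ^ n * welfare v (M.alloc v) := by
    calc welfare v a ≤ β ^ n * ∏ i, ∑ j ∈ bundle a i, p i j := h2
      _ = (β * n / (1 - δ)) ^ n *
          (((1 - δ) / n) ^ n * ∏ i, ∑ j ∈ bundle a i, p i j) := by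
        rw [← mul_assoc, ← mul_pow]
        congr 2
        field_simp
      _ ≤ _ := mul_le_mul_of_nonneg_left h1 (by positivity)
  have h4 : (0 : ℝ) ≤ β * n / (1 - δ) := by positivity
  calc nsw v a ≤ ((β * n / (1 - δ)) ^ n * welfare v (M.alloc v)) ^ (1 / (n : ℝ)) :=
        Real.rpow_le_rpow (welfare_nonneg v a) h3 (by positivity)
    _ = _ := by
      rw [Real.mul_rpow (by positivity) (welfare_nonneg v _), nsw_eq, one_div,
        Real.pow_rpow_inv_natCast h4 (NeZero.ne n)]

end

section

/-! ### A program logic with time bounds -/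

@[simp] theorem Store.setNat_nat (s : Store) (a k x a' k' : ℕ) :
    (s.setNat a k x).nat a' k' = if a' = a ∧ k' = k then x else s.nat a' k' := by
  by_cases ha : a' = a
  · subst ha
    by_cases hk : k' = k <;> simp [Store.setNat, Function.update, hk]
  · simp [Store.setNat, Function.update, ha]

@[simp] theorem Store.setReal_real (s : Store) (a k : ℕ) (x : ℝ) (a' k' : ℕ) :
    (s.setReal a k x).real a' k' = if a' = a ∧ k' = k then x else s.real a' k' := by
  by_cases ha : a' = a
  · subst ha
    by_cases hk : k' = k <;> simp [Store.setReal, Function.update, hk]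
  · simp [Store.setReal, Function.update, ha]

@[simp] theorem Store.setNat_real (s : Store) (a k x : ℕ) : (s.setNat a k x).real = s.real := rfl

@[simp] theorem Store.setReal_nat (s : Store) (a k : ℕ) (x : ℝ) :
    (s.setReal a k x).nat = s.nat := rfl

/-- The memories `s` and `s'` agree, except possibly in the integer arrays `A` and the real
arrays `B`. -/
structure AgreesOff (A B : List ℕ) (s s' : Store) : Prop where
  nat : ∀ a, a ∉ A → s'.nat a = s.nat a
  real : ∀ b, b ∉ B → s'.real b = s.real b

namespace AgreesOff

variable {A B A' B' : List ℕ} {s s' s'' : Store}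

theorem refl : AgreesOff A B s s := ⟨fun _ _ => rfl, fun _ _ => rfl⟩

theorem trans (h : AgreesOff A B s s') (h' : AgreesOff A B s' s'') : AgreesOff A B s s'' :=
  ⟨fun a ha => (h'.nat a ha).trans (h.nat a ha), fun b hb => (h'.real b hb).trans (h.real b hb)⟩

theorem mono (h : AgreesOff A B s s') (hA : A ⊆ A') (hB : B ⊆ B') : AgreesOff A' B' s s' :=
  ⟨fun a ha => h.nat a fun h => ha (hA h), fun b hb => h.real b fun h => hb (hB h)⟩

theorem setNat (h : AgreesOff A B s s') {a : ℕ} (ha : a ∈ A) (k x : ℕ) :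
    AgreesOff A B s (s'.setNat a k x) :=
  ⟨fun b hb => by
    rw [← h.nat b hb]
    exact Function.update_of_ne (by rintro rfl; exact hb ha) _ _, h.real⟩

theorem setReal (h : AgreesOff A B s s') {b : ℕ} (hb : b ∈ B) (k : ℕ) (x : ℝ) :
    AgreesOff A B s (s'.setReal b k x) :=
  ⟨h.nat, fun c hc => by
    rw [← h.real c hc]
    exact Function.update_of_ne (by rintro rfl; exact hc hb) _ _⟩

end AgreesOff

/-- Started on the memory `s`, the program `P` halts within `T` steps in a memory that
satisfies `Q`. -/
def Runs {n m : ℕ} (W : ℕ) (v : Fin n → Valuation m) (P : Program) (s : Store) (T : ℕ)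
    (Q : Store → Prop) : Prop :=
  ∃ s' t, Exec W v P s s' t ∧ t ≤ T ∧ Q s'

/-- Sequential composition of programs. -/
infixr:60 " ;; " => Program.seq

/-- An integer variable: cell `0` of an array. -/
abbrev NExp.var (a : ℕ) : NExp := .get a (.lit 0)

/-- A real variable: cell `0` of an array. -/
abbrev RExp.var (a : ℕ) : RExp := .get a (.lit 0)

/-- Assignment to an integer variable. -/
abbrev Program.setVar (a : ℕ) (e : NExp) : Program := .setNat a (.lit 0) e

/-- `for x < y do P`, where `x` and `y` are integer variables. -/
def Program.forLoop (x y : ℕ) (P : Program) : Program :=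
  .setVar x (.lit 0) ;; .loop (.natLt (.var x) (.var y)) (P ;; .setVar x (.add (.var x) (.lit 1)))

namespace Runs

variable {n m W : ℕ} {v : Fin n → Valuation m} {P P' : Program} {s : Store} {T T' T₁ T₂ : ℕ}
  {Q Q' : Store → Prop}

theorem mono (h : Runs W v P s T' Q') (hT : T' ≤ T) (hQ : ∀ s', Q' s' → Q s') :
    Runs W v P s T Q := by
  obtain ⟨s', t, h1, h2, h3⟩ := h
  exact ⟨s', t, h1, h2.trans hT, hQ _ h3⟩

theorem skip (hT : 1 ≤ T) (hQ : Q s) : Runs W v .skip s T Q := ⟨s, 1, .skip s, hT, hQ⟩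

theorem setNat {a : ℕ} {k e : NExp} (hk : k.Fits W s) (he : e.Fits W s)
    (hT : k.cost + e.cost + 1 ≤ T) (hQ : Q (s.setNat a (k.eval s) (e.eval s))) :
    Runs W v (.setNat a k e) s T Q := ⟨_, _, .setNat a k e s hk he, hT, hQ⟩

theorem setVar {a : ℕ} {e : NExp} (he : e.Fits W s) (hT : e.cost + 2 ≤ T)
    (hQ : Q (s.setNat a 0 (e.eval s))) : Runs W v (.setVar a e) s T Q :=
  setNat (Nat.zero_le W) he (by simp only [NExp.cost]; omega) hQ

theorem setReal {a : ℕ} {k : NExp} {e : RExp} (hk : k.Fits W s) (he : e.Fits W s)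
    (hT : k.cost + e.cost + 1 ≤ T) (hQ : Q (s.setReal a (k.eval s) (e.eval s))) :
    Runs W v (.setReal a k e) s T Q := ⟨_, _, .setReal a k e s hk he, hT, hQ⟩

theorem seq (h : Runs W v P s T₁ fun s' => Runs W v P' s' T₂ Q) (hT : T₁ + T₂ ≤ T) :
    Runs W v (P ;; P') s T Q := by
  obtain ⟨s', t, h1, h2, s'', t', h3, h4, h5⟩ := h
  exact ⟨s'', t + t', .seq P P' s s' s'' t t' h1 h3, by omega, h5⟩

theorem seq_of {R : Store → Prop} (h : Runs W v P s T₁ R) (hT : T₁ + T₂ ≤ T)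
    (h' : ∀ s', R s' → Runs W v P' s' T₂ Q) : Runs W v (P ;; P') s T Q :=
  seq (h.mono le_rfl h') hT

theorem setNat_seq {a : ℕ} {k e : NExp} (hk : k.Fits W s) (he : e.Fits W s)
    (h : Runs W v P (s.setNat a (k.eval s) (e.eval s)) T' Q) (hT : k.cost + e.cost + 1 + T' ≤ T) :
    Runs W v (.setNat a k e ;; P) s T Q := seq (setNat hk he le_rfl h) hT

theorem setVar_seq {a : ℕ} {e : NExp} (he : e.Fits W s)
    (h : Runs W v P (s.setNat a 0 (e.eval s)) T' Q) (hT : e.cost + 2 + T' ≤ T) :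
    Runs W v (.setVar a e ;; P) s T Q := seq (setVar he le_rfl h) hT

theorem ite {b : BExp} (hb : b.Fits W s) (hT : b.cost + T' + 1 ≤ T)
    (h1 : b.Holds s → Runs W v P s T' Q) (h2 : ¬ b.Holds s → Runs W v P' s T' Q) :
    Runs W v (.ite b P P') s T Q := by
  by_cases h : b.Holds s
  · obtain ⟨s', t, h3, h4, h5⟩ := h1 h
    exact ⟨s', _, .iteTrue b P P' s s' t hb h h3, by omega, h5⟩
  · obtain ⟨s', t, h3, h4, h5⟩ := h2 h
    exact ⟨s', _, .iteFalse b P P' s s' t hb h h3, by omega, h5⟩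

theorem query {r a : ℕ} {k i c : NExp} (hk : k.Fits W s) (hi : i.Fits W s) (hc : c.Fits W s)
    (hn : i.eval s < n) (hT : k.cost + i.cost + c.cost + 1 ≤ T)
    (hQ : Q (s.setReal r (k.eval s)
      ((v ⟨i.eval s, hn⟩).val (Finset.univ.filter fun j : Fin m => s.nat a j = c.eval s)))) :
    Runs W v (.query r k i a c) s T Q :=
  ⟨_, _, .query r k i a c s hk hi hc hn, hT, hQ⟩

/-- The rule for loops: `I k` is the invariant at the start of round `k`, which takes `f k`
steps. -/
theorem forLoop {x y N : ℕ} (I : ℕ → Store → Prop) (f : ℕ → ℕ) (hxy : y ≠ x)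
    (hy : s.nat y 0 = N) (hN : N ≤ W) (hT : ∑ k ∈ Finset.range N, (f k + 12) + 9 ≤ T)
    (h0 : I 0 (s.setNat x 0 0))
    (hstep : ∀ k s', k < N → I k s' → s'.nat x 0 = k → s'.nat y 0 = N →
      Runs W v P s' (f k) fun s'' =>
        s''.nat x 0 = k ∧ s''.nat y 0 = N ∧ I (k + 1) (s''.setNat x 0 (k + 1)))
    (hQ : ∀ s', I N s' → Q s') :
    Runs W v (.forLoop x y P) s T Q := by
  have key : ∀ d k s', k + d = N → I k s' → s'.nat x 0 = k → s'.nat y 0 = N →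
      Runs W v (.loop (.natLt (.var x) (.var y)) (P ;; .setVar x (.add (.var x) (.lit 1)))) s'
        (∑ i ∈ Finset.range d, (f (k + i) + 12) + 6) Q := by
    intro d
    induction d with
    | zero =>
      intro k s' hk hI hx hy'
      refine ⟨s', _, .loopEnd _ _ s' ?_ ?_, ?_, hQ _ ?_⟩
      · simp only [BExp.Fits, NExp.Fits, NExp.eval]; omega
      · simp only [BExp.Holds, NExp.eval]; omega
      · simp [BExp.cost, NExp.cost]
      · rwa [← hk]
    | succ d ih =>
      intro k s' hk hI hx hy'
      obtain ⟨s₁, t₁, hP, ht₁, hx₁, hy₁, hI₁⟩ := hstep k s' (by omega) hI hx hy'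
      obtain ⟨s₂, t₂, hL, ht₂, hQ₂⟩ := ih (k + 1) (s₁.setNat x 0 (k + 1)) (by omega) hI₁
        (by simp) (by simp [hxy, hy₁])
      have hset := Exec.setNat (v := v) (W := W) x (.lit 0) (.add (.var x) (.lit 1)) s₁
        (Nat.zero_le _) (by simp only [NExp.Fits, NExp.eval]; omega)
      simp only [NExp.eval, hx₁] at hset
      refine ⟨s₂, _, .loopStep _ _ s' _ s₂ _ t₂ ?_ ?_ (.seq _ _ _ _ _ _ _ hP hset) hL, ?_, hQ₂⟩
      · simp only [BExp.Fits, NExp.Fits, NExp.eval]; omega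
      · simp only [BExp.Holds, NExp.eval]; omega
      · rw [Finset.sum_range_succ']
        simp only [BExp.cost, NExp.cost, add_zero]
        have e : ∑ i ∈ Finset.range d, (f (k + (i + 1)) + 12)
            = ∑ i ∈ Finset.range d, (f (k + 1 + i) + 12) :=
          Finset.sum_congr rfl fun i _ => by rw [add_assoc, add_comm 1 i]
        rw [e]
        omega
  have h := key N 0 (s.setNat x 0 0) (zero_add N) h0 (by simp) (by simp [hxy, hy])
  simp only [zero_add] at h
  exact seq (T₁ := 3) (setVar (Nat.zero_le W) le_rfl h) (by omega)

/-- The rule for loops all of whose rounds take at most `c` steps. -/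
theorem forLoop_const {x y N : ℕ} (I : ℕ → Store → Prop) (c : ℕ) (hxy : y ≠ x)
    (hy : s.nat y 0 = N) (hN : N ≤ W) (hT : N * (c + 12) + 9 ≤ T)
    (h0 : I 0 (s.setNat x 0 0))
    (hstep : ∀ k s', k < N → I k s' → s'.nat x 0 = k → s'.nat y 0 = N →
      Runs W v P s' c fun s'' =>
        s''.nat x 0 = k ∧ s''.nat y 0 = N ∧ I (k + 1) (s''.setNat x 0 (k + 1)))
    (hQ : ∀ s', I N s' → Q s') :
    Runs W v (.forLoop x y P) s T Q :=
  forLoop I (fun _ => c) hxy hy hN (by simpa using hT) h0 hstep hQ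

end Runs

end

section

/-! ### Finding a prime -/

/-- Tests by trial division whether the integer variable `8` is prime; the answer goes to the
variable `9`. -/
def testPrime : Program :=
  .setVar 9 (.lit 1) ;;
  .forLoop 10 8 (.ite (.and (.natLt (.lit 1) (.var 10)) (.natEq (.mod (.var 8) (.var 10)) (.lit 0)))
    (.setVar 9 (.lit 0)) .skip)

/-- With `L = n * K + (n - 1) * m`, computes the largest prime `q` with `L < q ≤ 2 * L`. -/
def findPrime (K : ℕ) : Program :=
  .setVar 6 (.add (.mul (.var 0) (.lit K)) (.mul (.sub (.var 0) (.lit 1)) (.var 1))) ;;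
  .forLoop 7 6 (.setVar 8 (.add (.add (.var 6) (.lit 1)) (.var 7)) ;; testPrime ;;
    .ite (.natEq (.var 9) (.lit 1)) (.setVar 3 (.var 8)) .skip)

/-- The largest prime in `(L, L + k]`, or `0` if there is none. -/
def lastPrime (L : ℕ) : ℕ → ℕ
  | 0 => 0
  | k + 1 => if (L + 1 + k).Prime then L + 1 + k else lastPrime L k

theorem lastPrime_spec (L k : ℕ) :
    ((lastPrime L k).Prime ∧ L < lastPrime L k ∧ lastPrime L k ≤ L + k) ∨
      ∀ p, L < p → p ≤ L + k → ¬ p.Prime := by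
  induction k with
  | zero => right; intro p _ _; omega
  | succ k ih =>
    rw [lastPrime]
    split_ifs with h
    · exact Or.inl ⟨h, by omega, by omega⟩
    · rcases ih with ⟨h1, h2, h3⟩ | ih
      · exact Or.inl ⟨h1, h2, by omega⟩
      · right
        intro p hp hp'
        rcases Nat.lt_or_ge (L + k) p with h' | h'
        · rwa [show p = L + 1 + k by omega]
        · exact ih p hp h'

theorem lastPrime_bertrand {L : ℕ} (hL : L ≠ 0) :
    (lastPrime L L).Prime ∧ L < lastPrime L L ∧ lastPrime L L ≤ 2 * L := by
  rcases lastPrime_spec L L with h | h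
  · rwa [← two_mul] at h
  · obtain ⟨p, hp, h1, h2⟩ := Nat.exists_prime_lt_and_le_two_mul L hL
    exact absurd hp (h p h1 (by omega))

variable {n m W : ℕ} {v : Fin n → Valuation m} {s : Store}

theorem runs_testPrime {c : ℕ} (hc : s.nat 8 0 = c) (h2 : 2 ≤ c) (hW : c ≤ W) :
    Runs W v testPrime s (c * 28 + 12) fun s' =>
      AgreesOff [9, 10] [] s s' ∧ s'.nat 9 0 = if c.Prime then 1 else 0 := by
  refine Runs.setVar_seq (by simp only [NExp.Fits]; omega) (T' := c * 28 + 9) ?_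
    (by simp [NExp.cost]; omega)
  refine Runs.forLoop_const (N := c) (fun k s' => AgreesOff [9, 10] [] s s' ∧
    s'.nat 9 0 = if ∀ d < k, 2 ≤ d → ¬ d ∣ c then 1 else 0) 16 (by decide) (by simp [hc]) hW
    (by omega) ?_ ?_ ?_
  · refine ⟨(AgreesOff.refl.setNat (by decide) _ _).setNat (by decide) _ _, ?_⟩
    simp [NExp.eval]
  · rintro k s' hk ⟨hs, h9⟩ hx hy
    refine Runs.ite (T' := 3) ?_ (by simp [BExp.cost, NExp.cost]) ?_ ?_
    · simp only [BExp.Fits, NExp.Fits, NExp.eval]; omega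
    · intro hb
      simp only [BExp.Holds, NExp.eval, hx, hy] at hb
      refine Runs.setVar (Nat.zero_le _) (by simp [NExp.cost]) ⟨by simp [hx], by simp [hy],
        (hs.setNat (by decide) _ _).setNat (by decide) _ _, ?_⟩
      rw [if_neg]
      · simp [NExp.eval]
      · exact fun h => h k (by omega) hb.1 (Nat.dvd_of_mod_eq_zero hb.2)
    · intro hb
      simp only [BExp.Holds, NExp.eval, hx, hy] at hb
      refine Runs.skip (by omega) ⟨hx, hy, hs.setNat (by decide) _ _, ?_⟩
      have e : (s'.setNat 10 0 (k + 1)).nat 9 0 = s'.nat 9 0 := by simp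
      rw [e, h9]
      refine if_congr ⟨fun h d hd' hd hdc => ?_, fun h d hd' hd => h d (by omega) hd⟩ rfl rfl
      rcases Nat.lt_succ_iff_lt_or_eq.1 hd' with h' | rfl
      · exact h d h' hd hdc
      · exact hb ⟨by omega, Nat.mod_eq_zero_of_dvd hdc⟩
  · rintro s' ⟨hs, h9⟩
    refine ⟨hs, h9.trans (if_congr ?_ rfl rfl)⟩
    rw [Nat.prime_def_lt']
    exact ⟨fun h => ⟨h2, fun d hd hd' => h d hd' hd⟩, fun h d hd' hd => h.2 d hd hd'⟩

theorem runs_findPrime {K L : ℕ} (hn : s.nat 0 0 = n) (hm : s.nat 1 0 = m)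
    (h3 : s.nat 3 0 = 0) (hL : L = n * K + (n - 1) * m) (hn1 : 1 ≤ n) (hK : 1 ≤ K)
    (hW : 2 * L ≤ W) (hmW : m ≤ W) :
    Runs W v (findPrime K) s (56 * L ^ 2 + 45 * L + 23) fun s' =>
      AgreesOff [3, 6, 7, 8, 9, 10] [] s s' ∧ s'.nat 3 0 = lastPrime L L := by
  have h1 : n ≤ n * K := Nat.le_mul_of_pos_right n hK
  have h2 : K ≤ n * K := Nat.le_mul_of_pos_left K hn1
  refine Runs.setVar_seq ?_ (T' := 56 * L ^ 2 + 45 * L + 9) ?_ (by simp [NExp.cost]; omega)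
  · simp only [NExp.Fits, NExp.eval, hn, hm]
    omega
  refine Runs.forLoop_const (N := L) (fun k s' => AgreesOff [3, 6, 7, 8, 9, 10] [] s s' ∧
    s'.nat 3 0 = lastPrime L k) (56 * L + 33) (by decide)
    (by simp [NExp.eval, hn, hm, hL]) (by omega) (by nlinarith) ?_ ?_ ?_
  · exact ⟨(AgreesOff.refl.setNat (by decide) _ _).setNat (by decide) _ _,
      by simp [h3, lastPrime]⟩
  · rintro k s' hk ⟨hs, h3'⟩ hx hy
    refine Runs.setVar_seq (T' := 56 * L + 24) ?_ ?_ (by simp [NExp.cost]; omega)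
    · simp only [NExp.Fits, NExp.eval, hx, hy]; omega
    refine Runs.seq ((runs_testPrime (c := L + 1 + k) (by simp [NExp.eval, hx, hy]) (by omega)
      (by omega)).mono (show _ ≤ 56 * L + 12 by omega) ?_) (T₂ := 12) (by omega)
    rintro s'' ⟨hs'', h9⟩
    have g7 : s''.nat 7 0 = k := by rw [hs''.nat 7 (by decide)]; simp [hx]
    have g6 : s''.nat 6 0 = L := by rw [hs''.nat 6 (by decide)]; simp [hy]
    have g8 : s''.nat 8 0 = L + 1 + k := by rw [hs''.nat 8 (by decide)]; simp [NExp.eval, hx, hy]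
    have g3 : s''.nat 3 0 = lastPrime L k := by rw [hs''.nat 3 (by decide)]; simp [h3']
    have hA : AgreesOff [3, 6, 7, 8, 9, 10] [] s s'' :=
      (hs.setNat (by decide) _ _).trans (hs''.mono (by decide) (by decide))
    refine Runs.ite (T' := 4) ?_ (by simp [BExp.cost, NExp.cost]) ?_ ?_
    · simp only [BExp.Fits, NExp.Fits, NExp.eval, h9]
      split_ifs <;> omega
    · intro hb
      simp only [BExp.Holds, NExp.eval, h9] at hb
      have hp : (L + 1 + k).Prime := by by_contra hp; simp [hp] at hb
      refine Runs.setVar ?_ (by simp [NExp.cost]) ⟨by simp [g7], by simp [g6],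
        (hA.setNat (by decide) _ _).setNat (by decide) _ _, by simp [NExp.eval, g8, lastPrime, hp]⟩
      simp only [NExp.Fits, NExp.eval]; omega
    · intro hb
      simp only [BExp.Holds, NExp.eval, h9] at hb
      have hp : ¬ (L + 1 + k).Prime := by intro hp; simp [hp] at hb
      exact Runs.skip (by omega) ⟨g7, g6, hA.setNat (by decide) _ _, by simp [lastPrime, hp, g3]⟩
  · exact fun s' h => h

end

section

variable {n m q W : ℕ} {v : Fin n → Valuation m} {s s' : Store} {A B : List ℕ}

/-! ### Evaluating polynomials and sorting the items -/

/-- The numbers that have to fit into a word. -/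
structure WordSize (n m q W : ℕ) : Prop where
  n_pos : 0 < n
  le_q : n ≤ q
  m_pos : 0 < m
  m_le : m ≤ W
  qm_le : 2 * (q * m) ≤ W
  qn_le : q * n + 2 * q + n ≤ W
  pow_le : q ^ (n - 1) ≤ W

/-- The parameters of the program are in place: `n`, `m`, the prime `q`, `n - 1`, and the number
of the polynomials of degree less than `n` without constant term. -/
structure Config (n m q : ℕ) (s : Store) : Prop where
  n_eq : s.nat 0 0 = n
  m_eq : s.nat 1 0 = m
  q_eq : s.nat 3 0 = q
  n1_eq : s.nat 4 0 = n - 1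
  pow_eq : s.nat 5 0 = q ^ (n - 1)

theorem Config.of_agreesOff (h : Config n m q s) (hs : AgreesOff A B s s')
    (hA : ∀ a ∈ [0, 1, 3, 4, 5], a ∉ A) : Config n m q s' where
  n_eq := by rw [hs.nat 0 (hA 0 (by decide)), h.n_eq]
  m_eq := by rw [hs.nat 1 (hA 1 (by decide)), h.m_eq]
  q_eq := by rw [hs.nat 3 (hA 3 (by decide)), h.q_eq]
  n1_eq := by rw [hs.nat 4 (hA 4 (by decide)), h.n1_eq]
  pow_eq := by rw [hs.nat 5 (hA 5 (by decide)), h.pow_eq]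

/-- Computes the parameters. -/
def setup (K : ℕ) : Program :=
  findPrime K ;; .setVar 4 (.sub (.var 0) (.lit 1)) ;; .setVar 5 (.lit 1) ;;
  .forLoop 15 4 (.setVar 5 (.mul (.var 5) (.var 3)))

theorem runs_setup {K L : ℕ} (hs : s = initialStore n m) (hL : L = n * K + (n - 1) * m)
    (hK : 1 ≤ K) (hW : WordSize n m (lastPrime L L) W) (hLW : 2 * L ≤ W) :
    Runs W v (setup K) s (56 * L ^ 2 + 45 * L + 19 * n + 50) fun s' =>
      AgreesOff [3, 4, 5, 6, 7, 8, 9, 10, 15] [] s s' ∧ Config n m (lastPrime L L) s' := by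
  have hn := hW.n_pos
  refine Runs.seq ((runs_findPrime (L := L) (by simp [hs, initialStore]) (by simp [hs, initialStore])
    (by simp [hs, initialStore]) hL hn hK hLW hW.m_le).mono le_rfl ?_) (T₂ := 19 * n + 27) (by omega)
  rintro s₁ ⟨h₁, hq⟩
  set q := lastPrime L L with hqdef
  have g0 : s₁.nat 0 0 = n := by rw [h₁.nat 0 (by decide)]; simp [hs, initialStore]
  have g1 : s₁.nat 1 0 = m := by rw [h₁.nat 1 (by decide)]; simp [hs, initialStore]
  have hqn := hW.qn_le
  have hpow := hW.pow_le
  refine Runs.setVar_seq ?_ (T' := 19 * n + 12) ?_ (by simp [NExp.cost]; omega)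
  · simp only [NExp.Fits, NExp.eval, g0]; omega
  refine Runs.setVar_seq ?_ (T' := 19 * n + 9) ?_ (by simp [NExp.cost]; omega)
  · simp only [NExp.Fits]; omega
  refine Runs.forLoop_const (N := n - 1) (fun k s' =>
    AgreesOff [3, 4, 5, 6, 7, 8, 9, 10, 15] [] s s' ∧ s'.nat 0 0 = n ∧ s'.nat 1 0 = m ∧
      s'.nat 3 0 = q ∧ s'.nat 4 0 = n - 1 ∧ s'.nat 5 0 = q ^ k) 7 (by decide)
    (by simp [NExp.eval, g0]) (by omega) (by nlinarith [Nat.sub_le n 1]) ?_ ?_ ?_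
  · exact ⟨(((h₁.mono (by decide) (by decide)).setNat (by decide) _ _).setNat
      (by decide) _ _).setNat (by decide) _ _, by simp [g0], by simp [g1], by simp [hq],
      by simp [NExp.eval, g0], by simp [NExp.eval]⟩
  · rintro k s' hk ⟨h, k0, k1, k3, k4, k5⟩ hx hy
    have hk1 : q ^ (k + 1) ≤ q ^ (n - 1) := Nat.pow_le_pow_right (by have := hW.le_q; omega) hk
    have hk2 : q ^ k ≤ q ^ (n - 1) :=
      Nat.pow_le_pow_right (by have := hW.le_q; omega) (by omega)
    rw [pow_succ] at hk1
    refine Runs.setVar ?_ (by simp [NExp.cost]) ⟨by simp [hx], by simp [k4],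
      (h.setNat (by decide) _ _).setNat (by decide) _ _, by simp [k0], by simp [k1], by simp [k3],
      by simp [k4], by simp [NExp.eval, k5, k3, pow_succ]⟩
    simp only [NExp.Fits, NExp.eval, k5, k3]
    omega
  · rintro s' ⟨h, k0, k1, k3, k4, k5⟩
    exact ⟨h, k0, k1, k3, k4, k5⟩

/-- Horner's scheme modulo `q`, at `j`, for the polynomial without constant term whose
coefficients are the first `k` digits of `t` in base `q`. -/
def horner (q j t : ℕ) : ℕ → ℕ
  | 0 => 0
  | k + 1 => (horner q j t k + t / q ^ k % q) * j % q

theorem horner_lt (hq : 0 < q) (j t k : ℕ) : horner q j t k < q := by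
  cases k
  exacts [hq, Nat.mod_lt _ hq]

/-- Evaluates the polynomial with the number in the variable `11` at all items, into the
array `16`. -/
def evalPoly : Program :=
  .forLoop 12 1 (.setVar 13 (.lit 0) ;; .setVar 14 (.var 11) ;;
    .forLoop 15 4
      (.setVar 13 (.mod (.mul (.add (.var 13) (.mod (.var 14) (.var 3))) (.var 12)) (.var 3)) ;;
        .setVar 14 (.div (.var 14) (.var 3))) ;;
    .setNat 16 (.var 12) (.var 13))

theorem runs_evalPoly {t : ℕ} (hW : WordSize n m q W) (hc : Config n m q s)
    (ht : s.nat 11 0 = t) (htW : t ≤ W) :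
    Runs W v evalPoly s (m * (35 * n + 33) + 9) fun s' =>
      AgreesOff [12, 13, 14, 15, 16] [] s s' ∧ ∀ j < m, s'.nat 16 j = horner q j t (n - 1) := by
  have hn := hW.n_pos
  have hq : 0 < q := hn.trans_le hW.le_q
  have hqW := hW.qn_le
  have hmW := hW.m_le
  refine Runs.forLoop_const (N := m) (fun k s' => AgreesOff [12, 13, 14, 15, 16] [] s s' ∧
    ∀ j < k, s'.nat 16 j = horner q j t (n - 1)) (35 * n + 21) (by decide) hc.m_eq hmW
    (by nlinarith) ⟨AgreesOff.refl.setNat (by decide) _ _, by simp⟩ ?_ fun s' h => h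
  rintro j s₁ hj ⟨h₁, h16⟩ hx hy
  have c₁ := hc.of_agreesOff h₁ (by decide)
  have ht₁ : s₁.nat 11 0 = t := by rw [h₁.nat 11 (by decide), ht]
  refine Runs.setVar_seq (Nat.zero_le _) (T' := 35 * n + 18) ?_ (by simp [NExp.cost]; omega)
  refine Runs.setVar_seq ?_ (T' := 35 * n + 14) ?_ (by simp [NExp.cost]; omega)
  · simp [NExp.Fits, NExp.eval, ht₁, htW]
  refine Runs.seq (T₁ := 35 * n + 9) (T₂ := 5) (Runs.forLoop_const (N := n - 1) (fun k s' =>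
    AgreesOff [13, 14, 15] [] s₁ s' ∧ s'.nat 13 0 = horner q j t k ∧
      s'.nat 14 0 = t / q ^ k) 23 (by decide) (by simp [c₁.n1_eq]) (by omega) (by omega)
    ?_ ?_ ?_) (by omega)
  · exact ⟨((AgreesOff.refl.setNat (by decide) _ _).setNat (by decide) _ _).setNat
      (by decide) _ _, by simp [NExp.eval, horner], by simp [NExp.eval, ht₁]⟩
  · rintro k s₂ hk ⟨h₂, h13, h14⟩ hx₂ hy₂
    have h3 : s₂.nat 3 0 = q := by rw [h₂.nat 3 (by decide), c₁.q_eq]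
    have h12 : s₂.nat 12 0 = j := by rw [h₂.nat 12 (by decide), hx]
    have hhq := horner_lt hq j t k
    have hdq : t / q ^ k % q < q := Nat.mod_lt _ hq
    have htq : t / q ^ k ≤ W := (Nat.div_le_self _ _).trans htW
    have hprod : (horner q j t k + t / q ^ k % q) * j ≤ W :=
      (Nat.mul_le_mul (by omega : _ ≤ 2 * q) hj.le).trans (by rw [mul_assoc]; exact hW.qm_le)
    refine Runs.setVar_seq ?_ (T' := 7) (Runs.setVar ?_ (by simp [NExp.cost]) ?_)
      (by simp [NExp.cost])
    · simp only [NExp.Fits, NExp.eval, h13, h14, h3, h12]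
      omega
    · simp [NExp.Fits, NExp.eval, h14, h3, htq]
      omega
    · refine ⟨by simp [hx₂], by simp [hy₂], ((h₂.setNat (by decide) _ _).setNat
        (by decide) _ _).setNat (by decide) _ _, ?_, ?_⟩
      · simp [NExp.eval, h13, h14, h3, h12, horner]
      · simp [NExp.eval, h14, h3, Nat.div_div_eq_div_mul, pow_succ]
  · rintro s₂ ⟨h₂, h13, h14⟩
    have h12 : s₂.nat 12 0 = j := by rw [h₂.nat 12 (by decide), hx]
    have h1 : s₂.nat 1 0 = m := by rw [h₂.nat 1 (by decide), hy]
    have hhq := horner_lt hq j t (n - 1)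
    refine Runs.setNat ?_ ?_ (by simp [NExp.cost]) ?_
    · simp [NExp.Fits, NExp.eval, h12]; omega
    · simp [NExp.Fits, NExp.eval, h13]; omega
    · refine ⟨by simp [h12], by simp [h1], ((h₁.trans (h₂.mono (by decide) (by decide))).setNat
        (by decide) _ _).setNat (by decide) _ _, ?_⟩
      intro j' hj'
      simp only [NExp.eval, Store.setNat_nat, h12, h13]
      by_cases e : j' = j
      · simp [e]
      · simp [e, h₂.nat 16 (by decide), h16 j' (by omega)]

/-- Sorts the items by the values in the array `16`: the items of value `b` are listed in the
array `18` from cell `b * m` on, and cell `b` of the array `17` holds their number. -/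
def fillBuckets : Program :=
  .forLoop 21 3 (.setNat 17 (.var 21) (.lit 0)) ;;
  .forLoop 12 1 (.setVar 21 (.get 16 (.var 12)) ;;
    .setNat 18 (.add (.mul (.var 21) (.var 1)) (.get 17 (.var 21))) (.var 12) ;;
    .setNat 17 (.var 21) (.add (.get 17 (.var 21)) (.lit 1)))

/-- The number of the first `k` items that have the value `b`. -/
def bucketSize (y : ℕ → ℕ) (k b : ℕ) : ℕ := ((Finset.range k).filter fun j => y j = b).card

theorem bucketSize_succ (y : ℕ → ℕ) (k b : ℕ) :
    bucketSize y (k + 1) b = bucketSize y k b + if y k = b then 1 else 0 := by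
  rw [bucketSize, Finset.range_add_one, Finset.filter_insert]
  split_ifs with h
  · rw [Finset.card_insert_of_notMem (by simp), bucketSize]
  · rfl

theorem bucketSize_le (y : ℕ → ℕ) (k b : ℕ) : bucketSize y k b ≤ k :=
  (Finset.card_filter_le _ _).trans (by simp)

/-- The first `k` items are sorted into the buckets by their values `y`. -/
structure Buckets (m q : ℕ) (y : ℕ → ℕ) (k : ℕ) (s : Store) : Prop where
  size : ∀ b < q, s.nat 17 b = bucketSize y k b
  exists_mem : ∀ j < k, ∃ i < bucketSize y k (y j), s.nat 18 (y j * m + i) = j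
  value : ∀ b < q, ∀ i < bucketSize y k b, s.nat 18 (b * m + i) < k ∧
    y (s.nat 18 (b * m + i)) = b

theorem Buckets.congr {y : ℕ → ℕ} {k : ℕ} (h : Buckets m q y k s) (h17 : s'.nat 17 = s.nat 17)
    (h18 : s'.nat 18 = s.nat 18) : Buckets m q y k s' where
  size := by rw [h17]; exact h.size
  exists_mem := by rw [h18]; exact h.exists_mem
  value := by rw [h18]; exact h.value

theorem mul_add_inj {b b' i i' : ℕ} (hi : i < m) (hi' : i' < m) (h : b * m + i = b' * m + i') :
    b = b' ∧ i = i' := by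
  have h1 := congrArg (· / m) h
  have hm : 0 < m := by omega
  simp only [mul_comm _ m, Nat.mul_add_div hm, Nat.div_eq_of_lt hi, Nat.div_eq_of_lt hi',
    add_zero] at h1
  subst h1
  exact ⟨rfl, by omega⟩

theorem runs_fillBuckets {y : ℕ → ℕ} (hW : WordSize n m q W) (hc : Config n m q s)
    (hy : ∀ j < m, s.nat 16 j = y j) (hyq : ∀ j < m, y j < q) :
    Runs W v fillBuckets s (16 * q + 37 * m + 18) fun s' =>
      AgreesOff [12, 17, 18, 21] [] s s' ∧ Buckets m q y m s' := by
  have hn := hW.n_pos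
  have hmW := hW.m_le
  have hqW := hW.qn_le
  have hqmW := hW.qm_le
  refine Runs.seq (T₁ := 16 * q + 9) (T₂ := 37 * m + 9) (Runs.forLoop_const (N := q) (fun k s' =>
    AgreesOff [12, 17, 18, 21] [] s s' ∧ ∀ b < k, s'.nat 17 b = 0) 4 (by decide) hc.q_eq (by omega)
    (by omega) ⟨AgreesOff.refl.setNat (by decide) _ _, by simp⟩ ?_ ?_) (by omega)
  · rintro k s₁ hk ⟨h₁, h17⟩ hx hy₁
    refine Runs.setNat ?_ (Nat.zero_le _) (by simp [NExp.cost]) ⟨by simp [hx], by simp [hy₁],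
      (h₁.setNat (by decide) _ _).setNat (by decide) _ _, ?_⟩
    · simp [NExp.Fits, NExp.eval, hx]; omega
    · intro b hb
      simp only [NExp.eval, Store.setNat_nat, hx]
      by_cases e : b = k
      · simp [e]
      · simp [e, h17 b (by omega)]
  rintro s₁ ⟨h₁, h17⟩
  have c₁ := hc.of_agreesOff h₁ (by decide)
  refine Runs.forLoop_const (N := m) (fun k s' =>
    AgreesOff [12, 17, 18, 21] [] s s' ∧ Buckets m q y k s') 25 (by decide) c₁.m_eq (by omega)
    (by omega) ⟨h₁.setNat (by decide) _ _, ?_⟩ ?_ fun s' h => h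
  · exact ⟨fun b hb => by simp [h17 b hb, bucketSize], by simp, by simp [bucketSize]⟩
  rintro k s₂ hk ⟨h₂, hB⟩ hx hy₂
  have c₂ := hc.of_agreesOff h₂ (by decide)
  have h16 : s₂.nat 16 k = y k := by rw [h₂.nat 16 (by decide), hy k hk]
  have hyk := hyq k hk
  have hsz := bucketSize_le y k (y k)
  have h17 := hB.size _ hyk
  have haddr : y k * m + bucketSize y k (y k) ≤ q * m := by
    calc y k * m + bucketSize y k (y k) ≤ y k * m + m := by omega
      _ = (y k + 1) * m := by ring
      _ ≤ q * m := Nat.mul_le_mul_right m hyk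
  refine Runs.setVar_seq ?_ (T' := 20) ?_ (by simp [NExp.cost])
  · simp [NExp.Fits, NExp.eval, hx, h16]; omega
  refine Runs.setNat_seq ?_ ?_ (T' := 8) ?_ (by simp [NExp.cost])
  · simp [NExp.Fits, NExp.eval, hx, h16, hy₂, h17]; omega
  · simp [NExp.Fits, NExp.eval, hx]; omega
  refine Runs.setNat ?_ ?_ (by simp [NExp.cost]) ?_
  · simp [NExp.Fits, NExp.eval, hx, h16]; omega
  · simp [NExp.Fits, NExp.eval, hx, h16, h17]; omega
  refine ⟨by simp [hx], by simp [hy₂], (((h₂.setNat (by decide) _ _).setNat (by decide) _ _).setNat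
    (by decide) _ _).setNat (by decide) _ _, ?_⟩
  simp only [NExp.eval, hx, h16, hy₂, Store.setNat_nat]
  constructor
  · intro b hb
    rw [bucketSize_succ]
    by_cases e : b = y k
    · simp [e, h17]
    · simp [e, Ne.symm e, hB.size b hb]
  · intro j hj
    rcases Nat.lt_succ_iff_lt_or_eq.1 hj with hj' | rfl
    · obtain ⟨i, hi, hi'⟩ := hB.exists_mem j hj'
      refine ⟨i, hi.trans_le (by rw [bucketSize_succ]; omega), ?_⟩
      have hne : ¬ y j * m + i = y k * m + bucketSize y k (y k) := by
        intro e
        obtain ⟨e1, e2⟩ := mul_add_inj (hi.trans_le ((bucketSize_le y k _).trans hk.le))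
          (hsz.trans_lt hk) e
        rw [← e1] at e2
        omega
      simp [hne, hi', h17]
    · exact ⟨bucketSize y j (y j), by simp [bucketSize_succ], by simp [h17]⟩
  · intro b hb i hi
    by_cases e : b * m + i = y k * m + bucketSize y k (y k)
    · have hi' : i < m := hi.trans_le ((bucketSize_le y (k + 1) b).trans hk)
      obtain ⟨e1, e2⟩ := mul_add_inj hi' (hsz.trans_lt hk) e
      simp [h17, e1, e2]
    · have hi' : i < bucketSize y k b := by
        rw [bucketSize_succ] at hi
        split_ifs at hi with hb'
        · subst hb'
          have : i ≠ bucketSize y k (y k) := fun h => e (by rw [h])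
          omega
        · exact hi
      obtain ⟨e1, e2⟩ := hB.value b hb i hi'
      simp only [Store.setNat_nat]
      simp [e, h17, e2]
      omega

end

section

variable {n m q W : ℕ} {v : Fin n → Valuation m} {s s' : Store} {A B : List ℕ}

/-! ### Sweeping the constant term -/

/-- The owner of an item for which the polynomial without constant term has the value `y`, after
the constant `c` has been added; players are numbered from `1`. -/
def ownerCode (n q y c : ℕ) : ℕ := (y + c) % q * n / q + 1

/-- Allocates the items by their values in the array `16`, shifted by the variable `19`. -/
def setOwners : Program :=
  .forLoop 12 1 (.setNat 2 (.var 12) (.add (.div (.mul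
    (.mod (.add (.get 16 (.var 12)) (.var 19)) (.var 3)) (.var 0)) (.var 3)) (.lit 1)))

theorem runs_setOwners {y : ℕ → ℕ} {c : ℕ} (hW : WordSize n m q W) (hc : Config n m q s)
    (hy : ∀ j < m, s.nat 16 j = y j) (hyq : ∀ j < m, y j < q) (hs : s.nat 19 0 = c) (hcq : c < q) :
    Runs W v setOwners s (m * 32 + 9) fun s' =>
      AgreesOff [2, 12] [] s s' ∧ ∀ j < m, s'.nat 2 j = ownerCode n q (y j) c := by
  have hn := hW.n_pos
  have hmW := hW.m_le
  have hqW := hW.qn_le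
  refine Runs.forLoop_const (N := m) (fun k s' => AgreesOff [2, 12] [] s s' ∧
    ∀ j < k, s'.nat 2 j = ownerCode n q (y j) c) 20 (by decide) hc.m_eq hmW
    (by omega) ⟨AgreesOff.refl.setNat (by decide) _ _, by simp⟩ ?_ fun s' h => h
  rintro k s₁ hk ⟨h₁, h2⟩ hx hy₁
  have c₁ := hc.of_agreesOff h₁ (by decide)
  have h16 : s₁.nat 16 k = y k := by rw [h₁.nat 16 (by decide), hy k hk]
  have h19 : s₁.nat 19 0 = c := by rw [h₁.nat 19 (by decide), hs]
  have hyk := hyq k hk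
  have hmod : (y k + c) % q < q := Nat.mod_lt _ (by omega)
  have hmul : (y k + c) % q * n ≤ q * n := Nat.mul_le_mul_right n hmod.le
  have hdiv : (y k + c) % q * n / q ≤ n :=
    Nat.div_le_of_le_mul hmul
  refine Runs.setNat ?_ ?_ (by simp [NExp.cost]) ⟨by simp [hx], by simp [hy₁],
    (h₁.setNat (by decide) _ _).setNat (by decide) _ _, ?_⟩
  · simp [NExp.Fits, NExp.eval, hx]; omega
  · simp only [NExp.Fits, NExp.eval, hx, h16, h19, c₁.q_eq, c₁.n_eq]
    omega
  · intro j hj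
    simp only [NExp.eval, Store.setNat_nat, hx, h16, h19, c₁.q_eq, c₁.n_eq]
    by_cases e : j = k
    · simp [e, ownerCode]
    · simp [e, h2 j (by omega)]

theorem firstResidue_lt {i : ℕ} (hi : i < n) (hnq : n ≤ q) : firstResidue n q i < q := by
  rw [firstResidue, Nat.div_lt_iff_lt_mul (by omega)]
  obtain ⟨d, rfl⟩ := Nat.exists_eq_add_of_le (Nat.succ_le_of_lt hi)
  have : 0 ≤ d * q := Nat.zero_le _
  have e : q * (i.succ + d) = i * q + q + d * q := by rw [Nat.succ_eq_add_one]; ring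
  omega

theorem firstResidue_mul_div {i : ℕ} (hn : 0 < n) (hnq : n ≤ q) :
    firstResidue n q i * n / q = i := by
  have h1 := (le_firstResidue_iff (q := q) (i := i) (x := firstResidue n q i) hn).1 le_rfl
  have h2 : firstResidue n q i < firstResidue n q (i + 1) := by
    have : firstResidue n q i + 1 ≤ firstResidue n q (i + 1) := by
      rw [firstResidue, firstResidue, ← Nat.add_div_right _ hn]
      exact Nat.div_le_div_right (by rw [add_mul]; omega)
    omega
  rw [← not_le, le_firstResidue_iff hn] at h2
  omega

/-- Adding one to a residue that does not become the first residue of an interval does not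
change its interval. -/
theorem ownerCode_eq_of_ne {y c : ℕ} (hn : 0 < n) (hnq : n ≤ q)
    (h : ∀ i < n, firstResidue n q i ≠ (y + c) % q) :
    ownerCode n q y (c + (q - 1)) = ownerCode n q y c := by
  have hq : 0 < q := hn.trans_le hnq
  set x := (y + c) % q with hx
  have hxq : x < q := Nat.mod_lt _ hq
  have h0 : x ≠ 0 := by
    intro h0
    refine h 0 hn ?_
    rw [h0, firstResidue, zero_mul, zero_add, Nat.div_eq_of_lt (by omega)]
  have hprev : (y + (c + (q - 1))) % q = x - 1 := by
    have e : y + (c + (q - 1)) = (x - 1) + q * ((y + c) / q + 1) := by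
      have := Nat.mod_add_div (y + c) q
      rw [mul_add, mul_one]
      omega
    rw [e, Nat.add_mul_mod_self_left, Nat.mod_eq_of_lt (by omega)]
  have hin : x * n / q < n := Nat.div_lt_of_lt_mul (Nat.mul_lt_mul_of_pos_right hxq hn)
  have h1 : firstResidue n q (x * n / q) ≤ x :=
    (le_firstResidue_iff hn).2 (Or.inl le_rfl)
  have h2 : firstResidue n q (x * n / q) ≤ x - 1 := by
    have := h _ hin
    omega
  have h3 := (le_firstResidue_iff hn).1 h2
  have h4 : (x - 1) * n / q ≤ x * n / q :=
    Nat.div_le_div_right (Nat.mul_le_mul_right n (Nat.sub_le x 1))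
  rw [ownerCode, ownerCode, hprev, ← hx]
  omega

/-- The value of the items that move to player `i` when the constant becomes `c`. -/
def movingValue (n q i c : ℕ) : ℕ := (firstResidue n q i + q - c) % q

/-- Passes from the constant `c - 1` to the constant `c` in the variable `19`, moving only the
items whose owner changes. -/
def sweepStep : Program :=
  .forLoop 20 0
    (.setVar 21 (.mod (.sub (.add (.div (.add (.mul (.var 20) (.var 3)) (.var 4)) (.var 0))
      (.var 3)) (.var 19)) (.var 3)) ;;
    .setVar 22 (.get 17 (.var 21)) ;;
    .forLoop 23 22 (.setNat 2 (.get 18 (.add (.mul (.var 21) (.var 1)) (.var 23)))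
      (.add (.var 20) (.lit 1))))

theorem movingValue_add_mod {i c : ℕ} (hi : i < n) (hnq : n ≤ q) (hc : c < q) :
    (movingValue n q i c + c) % q = firstResidue n q i := by
  have := firstResidue_lt hi hnq
  rw [movingValue, Nat.mod_add_mod, Nat.sub_add_cancel (by omega), Nat.add_mod_right,
    Nat.mod_eq_of_lt this]

/-- While the buckets are emptied, every item either has its new owner, or has the old one and
does not lie in the buckets emptied so far. -/
theorem runs_sweepStep {y : ℕ → ℕ} {c : ℕ} (hW : WordSize n m q W) (hc : Config n m q s)
    (hyq : ∀ j < m, y j < q) (hB : Buckets m q y m s) (hs : s.nat 19 0 = c) (hcq : c < q)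
    (hown : ∀ j < m, s.nat 2 j = ownerCode n q (y j) (c + (q - 1))) :
    Runs W v sweepStep s
      (∑ i ∈ Finset.range n, (26 * bucketSize y m (movingValue n q i c) + 48) + 9) fun s' =>
      AgreesOff [2, 20, 21, 22, 23] [] s s' ∧
        ∀ j < m, s'.nat 2 j = ownerCode n q (y j) c := by
  have hn := hW.n_pos
  have hnq := hW.le_q
  have hq : 0 < q := hn.trans_le hnq
  have hmW := hW.m_le
  have hqW := hW.qn_le
  have hqmW := hW.qm_le
  have hpow := hW.pow_le
  refine Runs.forLoop (N := n) (fun k s' => AgreesOff [2, 20, 21, 22, 23] [] s s' ∧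
    ∀ j < m, s'.nat 2 j = ownerCode n q (y j) c ∨
      (s'.nat 2 j = ownerCode n q (y j) (c + (q - 1)) ∧
        ∀ i < k, firstResidue n q i ≠ (y j + c) % q))
    (fun i => 26 * bucketSize y m (movingValue n q i c) + 36) (by decide) hc.n_eq (by omega)
    (by simp only [add_assoc]; rfl) ⟨AgreesOff.refl.setNat (by decide) _ _, ?_⟩ ?_ ?_
  · intro j hj
    right
    simp [hown j hj]
  · rintro i s₁ hi ⟨h₁, h2⟩ hx hy₁
    have c₁ := hc.of_agreesOff h₁ (by decide)
    have hB₁ := hB.congr (h₁.nat 17 (by decide)) (h₁.nat 18 (by decide))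
    have h19 : s₁.nat 19 0 = c := by rw [h₁.nat 19 (by decide), hs]
    have hfirst := firstResidue_lt (q := q) hi hnq
    have hmv : movingValue n q i c < q := Nat.mod_lt _ hq
    have hiq : i * q ≤ q * n := by rw [mul_comm q]; exact Nat.mul_le_mul_right q hi.le
    set b := movingValue n q i c with hb
    have hsz := bucketSize_le y m b
    refine Runs.setVar_seq ?_ (T' := 26 * bucketSize y m b + 14) ?_ (by simp [NExp.cost]; omega)
    · have : (i * q + (n - 1)) / n < q := hfirst
      simp only [NExp.Fits, NExp.eval, hx, c₁.q_eq, c₁.n1_eq, c₁.n_eq, h19]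
      omega
    have hval : ((((NExp.var 20).mul (.var 3)).add (.var 4)).div (.var 0) |>.add (.var 3)
        |>.sub (.var 19) |>.mod (.var 3)).eval s₁ = b := by
      simp only [NExp.eval, hx, c₁.q_eq, c₁.n1_eq, c₁.n_eq, h19, hb, movingValue, firstResidue]
    rw [hval]
    refine Runs.setVar_seq ?_ (T' := 26 * bucketSize y m b + 9) ?_ (by simp [NExp.cost]; omega)
    · simp only [NExp.Fits, NExp.eval, Store.setNat_nat]
      simp [hB₁.size b hmv]
      omega
    refine Runs.forLoop_const (N := bucketSize y m b) (fun k s' =>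
      AgreesOff [2, 22, 23] [] (s₁.setNat 21 0 b) s' ∧
      (∀ j < m, s'.nat 2 j = ownerCode n q (y j) c ∨
        (s'.nat 2 j = ownerCode n q (y j) (c + (q - 1)) ∧
          (∀ i' < i, firstResidue n q i' ≠ (y j + c) % q) ∧
          ∀ k' < k, s.nat 18 (b * m + k') ≠ j))) 14 (by decide)
      (by simp [NExp.eval, hB₁.size b hmv]) (by omega) (by omega) ?_ ?_ ?_
    · refine ⟨(AgreesOff.refl.setNat (by decide) _ _).setNat (by decide) _ _, ?_⟩
      intro j hj
      simpa using h2 j hj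
    · rintro k s₂ hk ⟨h₂, h2'⟩ hx₂ hy₂
      have h18 : s₂.nat 18 = s.nat 18 := by
        rw [h₂.nat 18 (by decide), ← h₁.nat 18 (by decide)]
        funext k; simp
      have h21 : s₂.nat 21 0 = b := by rw [h₂.nat 21 (by decide)]; simp
      have h20 : s₂.nat 20 0 = i := by rw [h₂.nat 20 (by decide)]; simp [hx]
      have h1 : s₂.nat 1 0 = m := by rw [h₂.nat 1 (by decide)]; simp [c₁.m_eq]
      obtain ⟨hlt, hyv⟩ := hB.value b hmv k hk
      have haddr : b * m + k ≤ q * m := by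
        calc b * m + k ≤ b * m + m := by omega
          _ = (b + 1) * m := by ring
          _ ≤ q * m := Nat.mul_le_mul_right m hmv
      refine Runs.setNat ?_ ?_ (by simp [NExp.cost]) ⟨by simp [hx₂], by simp [hy₂],
        (h₂.setNat (by decide) _ _).setNat (by decide) _ _, ?_⟩
      · simp only [NExp.Fits, NExp.eval, hx₂, h21, h1, h18]
        omega
      · simp only [NExp.Fits, NExp.eval, h20]
        omega
      · intro j hj
        simp only [NExp.eval, hx₂, h21, h1, h18, h20, Store.setNat_nat]
        by_cases e : j = s.nat 18 (b * m + k)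
        · left
          subst e
          have e : ownerCode n q (y (s.nat 18 (b * m + k))) c = i + 1 := by
            rw [ownerCode, hyv, hb, movingValue_add_mod hi hnq hcq, firstResidue_mul_div hn hnq]
          simp [e]
        · have e' : (if 2 = 23 ∧ j = 0 then k + 1 else if True ∧ j = s.nat 18 (b * m + k) then i + 1
            else s₂.nat 2 j) = s₂.nat 2 j := by simp [e]
          rw [e']
          refine (h2' j hj).imp_right fun ⟨h1, h2, h3⟩ => ⟨h1, h2, fun k' hk' => ?_⟩
          rcases Nat.lt_succ_iff_lt_or_eq.1 hk' with h | rfl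
          · exact h3 k' h
          · exact Ne.symm e
    · rintro s₂ ⟨h₂, h2'⟩
      have hA : AgreesOff [2, 20, 21, 22, 23] [] s s₂ :=
        (h₁.setNat (by decide) _ _).trans (h₂.mono (by decide) (by decide))
      refine ⟨by rw [h₂.nat 20 (by decide)]; simp [hx], by rw [h₂.nat 0 (by decide)]; simp [hy₁],
        hA.setNat (by decide) _ _, ?_⟩
      intro j hj
      have e : (s₂.setNat 20 0 (i + 1)).nat 2 j = s₂.nat 2 j := by simp
      rw [e]
      refine (h2' j hj).imp_right fun ⟨h1, h2, h3⟩ => ⟨h1, fun i' hi' heq => ?_⟩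
      rcases Nat.lt_succ_iff_lt_or_eq.1 hi' with h | rfl
      · exact h2 i' h heq
      · -- An item that moves to player `i` lies in the bucket just emptied.
        have hyj := hyq j hj
        have hby : b = y j := by
          rw [hb, movingValue, heq]
          have hc' : c = c % q := (Nat.mod_eq_of_lt hcq).symm
          rcases Nat.lt_or_ge (y j + c) q with hlt | hge
          · rw [Nat.mod_eq_of_lt hlt, show y j + c + q - c = y j + q by omega,
              Nat.add_mod_right, Nat.mod_eq_of_lt hyj]
          · rw [Nat.mod_eq_sub_mod hge, Nat.mod_eq_of_lt (by omega : y j + c - q < q),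
              show y j + c - q + q - c = y j by omega, Nat.mod_eq_of_lt hyj]
        obtain ⟨k', hk', hk''⟩ := hB.exists_mem j hj
        exact h3 k' (by rwa [hby]) (by rwa [hby])
  · rintro s₁ ⟨h₁, h2⟩
    refine ⟨h₁, fun j hj => (h2 j hj).elim id fun ⟨h, h'⟩ => h.trans (ownerCode_eq_of_ne hn hnq h')⟩

/-- Over a whole sweep every item moves to player `i` just once. -/
theorem sum_bucketSize_movingValue {y : ℕ → ℕ} {i : ℕ} (hi : i < n) (hnq : n ≤ q) :
    ∑ c ∈ Finset.range q, bucketSize y m (movingValue n q i c) ≤ m := by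
  have hinj : Set.InjOn (fun c => movingValue n q i c) (Finset.range q) := by
    intro c hc c' hc' h
    simp only [Finset.coe_range, Set.mem_Iio] at hc hc'
    have hf := firstResidue_lt (q := q) hi hnq
    have h1 := movingValue_add_mod hi hnq hc
    have h2 := movingValue_add_mod hi hnq hc'
    dsimp only at h
    rw [h, ← h2] at h1
    have h3 : c % q = c' % q := Nat.ModEq.add_left_cancel' _ h1
    rwa [Nat.mod_eq_of_lt hc, Nat.mod_eq_of_lt hc'] at h3
  have hsum : ∑ c ∈ Finset.range q, bucketSize y m (movingValue n q i c)
      = ∑ b ∈ (Finset.range q).image (fun c => movingValue n q i c), bucketSize y m b :=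
    (Finset.sum_image hinj).symm
  rw [hsum]
  calc _ = (((Finset.range m).filter fun j => y j ∈
          (Finset.range q).image (fun c => movingValue n q i c)).card) := by
        simp only [bucketSize]
        rw [Finset.card_eq_sum_card_fiberwise (f := y)
          (t := (Finset.range q).image (fun c => movingValue n q i c))
          (by intro j hj; exact (Finset.mem_filter.1 hj).2)]
        refine Finset.sum_congr rfl fun b hb => ?_
        rw [Finset.filter_filter]
        congr 1
        ext j
        simp only [Finset.mem_filter, Finset.mem_range, and_congr_right_iff]
        exact fun _ => ⟨fun h => ⟨h ▸ hb, h⟩, fun h => h.2⟩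
    _ ≤ m := (Finset.card_filter_le _ _).trans (by simp)

end

section

/-! ### The assignments that the program enumerates -/

theorem cast_horner (q j t k : ℕ) : (horner q j t k : ZMod q)
    = ∑ i ∈ Finset.range k, ((t / q ^ i % q : ℕ) : ZMod q) * (j : ZMod q) ^ (k - i) := by
  induction k with
  | zero => simp [horner]
  | succ k ih =>
    rw [horner, ZMod.natCast_mod, Nat.cast_mul, Nat.cast_add, ih, Finset.sum_range_succ, add_mul,
      Finset.sum_mul, Nat.add_sub_cancel_left, pow_one]
    congr 1
    refine Finset.sum_congr rfl fun i hi => ?_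
    rw [mul_assoc, ← pow_succ, Nat.succ_sub (Finset.mem_range.1 hi).le]

section Enumeration

variable {n q : ℕ} [NeZero n] [NeZero q] (m : ℕ)

/-- The assignment given by the polynomial with the constant term `c` whose other coefficients
are the digits of `t` in base `q`. -/
def assignment (n q m : ℕ) [NeZero n] [NeZero q] (t c : ℕ) : Fin m → Fin n := fun j =>
  ⟨(horner q j t (n - 1) + c) % q * n / q, Nat.div_lt_of_lt_mul
    (Nat.mul_lt_mul_of_pos_right (Nat.mod_lt _ (NeZero.pos q)) (NeZero.pos n))⟩

theorem assignment_eq_sample {t c : ℕ} {w : Fin n → ZMod q} (h0 : w 0 = c)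
    (hw : ∀ i : Fin n, i ≠ 0 → w i = (t / q ^ (n - 1 - i) % q : ℕ)) :
    assignment n q m t c = sample m w := by
  obtain ⟨k, rfl⟩ := Nat.exists_eq_succ_of_ne_zero (NeZero.ne n)
  have key : ∀ j : ℕ, ((horner q j t k + c : ℕ) : ZMod q) = polyValue w (j : ZMod q) := by
    intro j
    rw [polyValue, Fin.sum_univ_succ, h0, Nat.cast_add, cast_horner,
      ← Finset.sum_range_reflect, add_comm, Finset.sum_range]
    congr 1
    · simp
    · refine Finset.sum_congr rfl fun i _ => ?_
      rw [hw _ (Fin.succ_ne_zero i)]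
      have e1 : k + 1 - 1 - ((i.succ : Fin (k + 1)) : ℕ) = k - 1 - i := by
        rw [Fin.val_succ]; omega
      have e2 : k - (k - 1 - (i : ℕ)) = i + 1 := by omega
      rw [e1, e2, Fin.val_succ]
  funext j
  have := key j
  simp only [assignment, sample, owner, Nat.succ_eq_add_one, Nat.add_sub_cancel, ← this,
    ZMod.val_natCast]

/-- The program enumerates exactly the support of `sampleDist`. -/
theorem range_sample_eq : Set.range (sample (n := n) (q := q) m)
    = {g | ∃ t c, t < q ^ (n - 1) ∧ c < q ∧ g = assignment n q m t c} := by
  ext g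
  constructor
  · rintro ⟨w, rfl⟩
    let d : Fin (n - 1) → Fin q := fun i => ⟨(w ⟨n - 1 - i, by omega⟩).val, ZMod.val_lt _⟩
    refine ⟨finFunctionFinEquiv d, (w 0).val, (finFunctionFinEquiv d).2, ZMod.val_lt _,
      (assignment_eq_sample m (by simp) fun i hi => ?_).symm⟩
    have hi0 : (i : ℕ) ≠ 0 := fun h => hi (Fin.ext h)
    have hin := i.2
    have h1 : n - 1 - (i : ℕ) < n - 1 := by omega
    have h2 : (finFunctionFinEquiv d : ℕ) / q ^ (n - 1 - (i : ℕ)) % q = d ⟨n - 1 - i, h1⟩ := by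
      conv_rhs => rw [← finFunctionFinEquiv.symm_apply_apply d]
      rfl
    rw [h2, ZMod.natCast_zmod_val]
    congr 1
    ext
    simp only
    omega
  · rintro ⟨t, c, -, -, rfl⟩
    refine ⟨fun i => if i = 0 then (c : ZMod q) else ((t / q ^ (n - 1 - i) % q : ℕ) : ZMod q),
      (assignment_eq_sample m (by simp) fun i hi => by simp [hi]).symm⟩

end Enumeration

/-! ### Queries and maxima -/

variable {n m q W : ℕ} {v : Fin n → Valuation m} {s s' : Store} {A B : List ℕ}

/-- Queries the values of the players for the allocation in the array `2`, and computes the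
products of the values of all players but one. -/
def assess : Program :=
  .forLoop 20 0 (.query 1 (.var 20) (.var 20) 2 (.add (.var 20) (.lit 1))) ;;
  .forLoop 20 0 (.setReal 2 (.lit 0) .one ;;
    .forLoop 24 0 (.ite (.natEq (.var 24) (.var 20)) .skip
      (.setReal 2 (.lit 0) (.mul (.var 2) (.get 1 (.var 24))))) ;;
    .setReal 3 (.var 20) (.var 2))

/-- The values of the players and the welfare of the others have been computed for `g`. -/
structure Assessed (v : Fin n → Valuation m) (g : Fin m → Fin n) (s : Store) : Prop where
  value : ∀ i : Fin n, s.real 1 i = (v i).val (bundle (full g) i)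
  others : ∀ i : Fin n, s.real 3 i = othersWelfare v i (full g)

theorem runs_assess {g : Fin m → Fin n} (hW : WordSize n m q W) (hc : Config n m q s)
    (hg : ∀ j : Fin m, s.nat 2 j = g j + 1) :
    Runs W v assess s (26 * n ^ 2 + 50 * n + 18) fun s' =>
      AgreesOff [20, 24] [1, 2, 3] s s' ∧ Assessed v g s' := by
  have hn := hW.n_pos
  have hqW := hW.qn_le
  have hnq := hW.le_q
  refine Runs.seq (T₁ := 21 * n + 9) (T₂ := 26 * n ^ 2 + 29 * n + 9) (Runs.forLoop_const (N := n)
    (fun k s' => AgreesOff [20, 24] [1, 2, 3] s s' ∧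
      ∀ i : Fin n, (i : ℕ) < k → s'.real 1 i = (v i).val (bundle (full g) i)) 9 (by decide) hc.n_eq
    (by omega) (by omega) ⟨AgreesOff.refl.setNat (by decide) _ _, by simp⟩ ?_ ?_) (by omega)
  · rintro k s₁ hk ⟨h₁, hv⟩ hx hy
    have h2 : s₁.nat 2 = s.nat 2 := h₁.nat 2 (by decide)
    refine Runs.query (by simp [NExp.Fits, NExp.eval, hx]; omega)
      (by simp [NExp.Fits, NExp.eval, hx]; omega) (by simp [NExp.Fits, NExp.eval, hx]; omega)
      (by simpa [NExp.eval, hx] using hk) (by simp [NExp.cost])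
      ⟨by simp [hx], by simp [hy], (h₁.setReal (by decide) _ _).setNat (by decide) _ _, ?_⟩
    intro i hi
    simp only [NExp.eval, hx, Store.setNat_real, Store.setReal_real, h2, true_and]
    split_ifs with e
    · have e' : (⟨k, hk⟩ : Fin n) = i := Fin.ext e.symm
      rw [e']
      congr 1
      ext j
      rw [mem_bundle, full, Option.some_inj, Finset.mem_filter, hg]
      simp only [Finset.mem_univ, true_and, Fin.ext_iff]
      omega
    · exact hv i (by omega)
  rintro s₁ ⟨h₁, hv⟩
  have c₁ := hc.of_agreesOff h₁ (by decide)
  refine Runs.forLoop_const (N := n) (fun k s' => AgreesOff [20, 24] [2, 3] s₁ s' ∧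
      ∀ i : Fin n, (i : ℕ) < k → s'.real 3 i = othersWelfare v i (full g)) (26 * n + 17) (by decide)
    c₁.n_eq (by omega) (by nlinarith) ⟨AgreesOff.refl.setNat (by decide) _ _, by simp⟩ ?_ ?_
  · rintro k s₂ hk ⟨h₂, ho⟩ hx hy
    refine Runs.seq (T₁ := 3) (T₂ := 26 * n + 14) (Runs.setReal (Nat.zero_le _) trivial
      (by simp [NExp.cost, RExp.cost]) ?_) (by omega)
    refine Runs.seq (T₁ := 26 * n + 9) (T₂ := 5) (Runs.forLoop_const (N := n) (fun l s' =>
      AgreesOff [24] [2] s₂ s' ∧ s'.real 2 0 = ∏ i ∈ Finset.univ.filter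
        (fun i : Fin n => (i : ℕ) < l ∧ (i : ℕ) ≠ k), (v i).val (bundle (full g) i)) 14 (by decide)
      (by simpa using hy) (by omega) (by omega)
      ⟨(AgreesOff.refl.setReal (by decide) _ _).setNat (by decide) _ _,
        by simp [NExp.eval, RExp.eval]⟩ ?_ ?_) (by omega)
    · rintro l s₃ hl ⟨h₃, hp⟩ hx₃ hy₃
      have h20 : s₃.nat 20 0 = k := by rw [h₃.nat 20 (by decide), hx]
      refine Runs.ite (T' := 8) ?_ (by simp [BExp.cost, NExp.cost]) ?_ ?_
      · simp [BExp.Fits, NExp.Fits, NExp.eval, hx₃, h20]; omega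
      · intro hb
        simp only [BExp.Holds, NExp.eval, hx₃, h20] at hb
        refine Runs.skip (by omega) ⟨hx₃, hy₃, h₃.setNat (by decide) _ _, ?_⟩
        rw [Store.setNat_real, hp]
        refine Finset.prod_congr (Finset.filter_congr fun i _ => ?_) fun _ _ => rfl
        omega
      · intro hb
        simp only [BExp.Holds, NExp.eval, hx₃, h20] at hb
        refine Runs.setReal (Nat.zero_le _) ?_ (by simp [NExp.cost, RExp.cost]) ⟨by simp [hx₃],
          by simp [hy₃], (h₃.setReal (by decide) _ _).setNat (by decide) _ _, ?_⟩
        · simp [RExp.Fits, NExp.Fits, NExp.eval, hx₃]; omega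
        · have h1 : s₃.real 1 l = (v ⟨l, hl⟩).val (bundle (full g) ⟨l, hl⟩) := by
            rw [h₃.real 1 (by decide), h₂.real 1 (by decide)]
            exact hv ⟨l, hl⟩ hl
          have e : (Finset.univ.filter fun i : Fin n => (i : ℕ) < l + 1 ∧ (i : ℕ) ≠ k)
              = insert ⟨l, hl⟩ (Finset.univ.filter fun i : Fin n => (i : ℕ) < l ∧ (i : ℕ) ≠ k) := by
            ext i
            simp only [Finset.mem_filter, Finset.mem_univ, true_and, Finset.mem_insert, Fin.ext_iff]
            omega
          simp only [NExp.eval, RExp.eval, Store.setNat_real, Store.setReal_real, hx₃, hp, h1]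
          rw [e, Finset.prod_insert (by simp), mul_comm]
          simp
    · rintro s₃ ⟨h₃, hp⟩
      have h20 : s₃.nat 20 0 = k := by rw [h₃.nat 20 (by decide), hx]
      have h0 : s₃.nat 0 0 = n := by rw [h₃.nat 0 (by decide), hy]
      refine Runs.setReal ?_ (Nat.zero_le _) (by simp [NExp.cost, RExp.cost]) ⟨by simp [h20],
        by simp [h0], ((h₂.trans (h₃.mono (by decide) (by decide))).setReal
          (by decide) _ _).setNat (by decide) _ _, ?_⟩
      · simp [NExp.Fits, NExp.eval, h20]; omega
      · intro i hi
        simp only [NExp.eval, RExp.eval, Store.setNat_real, Store.setReal_real, h20, true_and]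
        split_ifs with e
        · rw [hp, othersWelfare]
          refine Finset.prod_congr ?_ fun _ _ => rfl
          ext l
          simp only [Finset.mem_filter, Finset.mem_univ, true_and, Finset.mem_erase, ne_eq,
            Fin.ext_iff, and_true]
          omega
        · rw [h₃.real 3 (by decide)]
          exact ho i (by omega)
  · rintro s₂ ⟨h₂, ho⟩
    refine ⟨h₁.trans (h₂.mono (by decide) (by decide)), fun i => ?_, fun i => ho i i.2⟩
    rw [h₂.real 1 (by decide)]
    exact hv i i.2

/-- Updates the maxima: the highest welfare (real variable `5`, attained at the assignment with
the numbers in the variables `25` and `26`) and the highest welfare of the players other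
than `i` (cell `i` of the real array `4`). -/
def update : Program :=
  .forLoop 20 0 (.ite (.realLt (.get 4 (.var 20)) (.get 3 (.var 20)))
    (.setReal 4 (.var 20) (.get 3 (.var 20))) .skip) ;;
  .ite (.realLt (.var 5) (.mul (.var 3) (.var 1)))
    (.setReal 5 (.lit 0) (.mul (.var 3) (.var 1)) ;; .setVar 25 (.var 11) ;; .setVar 26 (.var 19))
    .skip

/-- The stored maxima bound the welfare of all assignments in `S`, and each of them is either its
initial value `0` or attained at an assignment of the enumeration. -/
structure Tracks {n m : ℕ} (q : ℕ) [NeZero n] [NeZero q] (v : Fin n → Valuation m)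
    (S : Set (Fin m → Fin n)) (s : Store) : Prop where
  le_best : ∀ g ∈ S, welfare v (full g) ≤ s.real 5 0
  best : s.real 5 0 = 0 ∨ (s.nat 25 0 < q ^ (n - 1) ∧ s.nat 26 0 < q ∧
    s.real 5 0 = welfare v (full (assignment n q m (s.nat 25 0) (s.nat 26 0))))
  le_others : ∀ i : Fin n, ∀ g ∈ S, othersWelfare v i (full g) ≤ s.real 4 i
  others : ∀ i : Fin n, s.real 4 i = 0 ∨ ∃ t c, t < q ^ (n - 1) ∧ c < q ∧
    s.real 4 i = othersWelfare v i (full (assignment n q m t c))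

end

section

variable {n m q W : ℕ} [NeZero n] [NeZero q] {v : Fin n → Valuation m} {s s' : Store}
  {A B : List ℕ}

theorem Tracks.congr {S S' : Set (Fin m → Fin n)} (h : Tracks q v S s) (hS : S' ⊆ S)
    (hs : AgreesOff A B s s') (h25 : 25 ∉ A) (h26 : 26 ∉ A) (h4 : 4 ∉ B) (h5 : 5 ∉ B) :
    Tracks q v S' s' where
  le_best g hg := by rw [hs.real 5 h5]; exact h.le_best g (hS hg)
  best := by rw [hs.real 5 h5, hs.nat 25 h25, hs.nat 26 h26]; exact h.best
  le_others i g hg := by rw [hs.real 4 h4]; exact h.le_others i g (hS hg)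
  others i := by rw [hs.real 4 h4]; exact h.others i

theorem runs_update {S : Set (Fin m → Fin n)} {t c : ℕ} (hW : WordSize n m q W)
    (hc : Config n m q s) (ht : s.nat 11 0 = t) (hs : s.nat 19 0 = c) (htq : t < q ^ (n - 1))
    (hcq : c < q) (ha : Assessed v (assignment n q m t c) s) (hT : Tracks q v S s) :
    Runs W v update s (26 * n + 33) fun s' => AgreesOff [20, 25, 26] [4, 5] s s' ∧
      Tracks q v (insert (assignment n q m t c) S) s' := by
  have hn := hW.n_pos
  have hqW := hW.qn_le
  have hpow := hW.pow_le
  set g := assignment n q m t c with hg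
  refine Runs.seq (T₁ := 26 * n + 9) (T₂ := 24) (Runs.forLoop_const (N := n)
    (fun k s' => AgreesOff [20] [4] s s' ∧ ∀ i : Fin n,
      s'.real 4 i = if (i : ℕ) < k then max (s.real 4 i) (othersWelfare v i (full g))
        else s.real 4 i) 14 (by decide) hc.n_eq (by omega) (by omega)
      ⟨AgreesOff.refl.setNat (by decide) _ _, by simp⟩ ?_ ?_) (by omega)
  · rintro k s₁ hk ⟨h₁, h4⟩ hx hy
    have h3 : s₁.real 3 k = othersWelfare v ⟨k, hk⟩ (full g) := by
      rw [h₁.real 3 (by decide)]; exact ha.others ⟨k, hk⟩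
    have h4k : s₁.real 4 k = s.real 4 k := by simpa using h4 ⟨k, hk⟩
    have hstep : ∀ i : Fin n, (i : ℕ) ≠ k →
        s₁.real 4 i = if (i : ℕ) < k + 1 then max (s.real 4 i) (othersWelfare v i (full g))
          else s.real 4 i := fun i hi =>
      (h4 i).trans (if_congr (by omega) rfl rfl)
    have hfits : NExp.Fits W s₁ (.var 20) := by simp [NExp.Fits, NExp.eval, hx]; omega
    refine Runs.ite (T' := 6) ⟨hfits, hfits⟩ (by simp [BExp.cost, NExp.cost, RExp.cost]) ?_ ?_
    · intro hb
      simp only [BExp.Holds, RExp.eval, NExp.eval, hx, h3, h4k] at hb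
      refine Runs.setReal hfits hfits (by simp [NExp.cost, RExp.cost]) ⟨by simp [hx], by simp [hy],
        (h₁.setReal (by decide) _ _).setNat (by decide) _ _, fun i => ?_⟩
      simp only [NExp.eval, RExp.eval, Store.setNat_real, Store.setReal_real, hx, h3, true_and]
      by_cases e : (i : ℕ) = k
      · have e' : i = ⟨k, hk⟩ := Fin.ext e
        subst e'
        simp [max_eq_right hb.le]
      · rw [if_neg e]
        exact hstep i e
    · intro hb
      simp only [BExp.Holds, RExp.eval, NExp.eval, hx, h3, h4k, not_lt] at hb
      refine Runs.skip (by omega) ⟨hx, hy, h₁.setNat (by decide) _ _, fun i => ?_⟩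
      rw [Store.setNat_real]
      by_cases e : (i : ℕ) = k
      · have e' : i = ⟨k, hk⟩ := Fin.ext e
        subst e'
        simp [max_eq_left hb, h4k]
      · exact hstep i e
  rintro s₁ ⟨h₁, h4⟩
  have hwel : s₁.real 3 0 * s₁.real 1 0 = welfare v (full g) := by
    rw [h₁.real 3 (by decide), h₁.real 1 (by decide), ← othersWelfare_mul v 0]
    have h1 := ha.others 0
    have h2 := ha.value 0
    rw [Fin.val_zero] at h1 h2
    rw [h1, h2]
  have h11 : s₁.nat 11 0 = t := by rw [h₁.nat 11 (by decide), ht]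
  have h19 : s₁.nat 19 0 = c := by rw [h₁.nat 19 (by decide), hs]
  have hoth : ∀ i : Fin n, ∀ g' ∈ insert g S, othersWelfare v i (full g') ≤ s₁.real 4 i := by
    intro i g' hg'
    rw [h4 i, if_pos i.2]
    rcases hg' with rfl | hg'
    · exact le_max_right _ _
    · exact (hT.le_others i g' hg').trans (le_max_left _ _)
  have hoth' : ∀ i : Fin n, s₁.real 4 i = 0 ∨ ∃ t c, t < q ^ (n - 1) ∧ c < q ∧
      s₁.real 4 i = othersWelfare v i (full (assignment n q m t c)) := by
    intro i
    rw [h4 i, if_pos i.2]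
    rcases max_choice (s.real 4 i) (othersWelfare v i (full g)) with e | e <;> rw [e]
    · exact hT.others i
    · exact Or.inr ⟨t, c, htq, hcq, rfl⟩
  refine Runs.ite (T' := 15) (by simp [BExp.Fits, RExp.Fits, NExp.Fits])
    (by simp [BExp.cost, NExp.cost, RExp.cost]) ?_ ?_
  · intro hb
    simp only [BExp.Holds, RExp.eval, NExp.eval, hwel, h₁.real 5 (by decide)] at hb
    refine Runs.seq (T₁ := 7) (T₂ := 8) (Runs.setReal (Nat.zero_le _)
      (by simp [RExp.Fits, NExp.Fits]) (by simp [NExp.cost, RExp.cost]) ?_) (by omega)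
    refine Runs.setVar_seq (T' := 4) ?_ (Runs.setVar ?_ (by simp [NExp.cost]) ?_)
      (by simp [NExp.cost])
    · simp [NExp.Fits, NExp.eval, h11]; omega
    · simp [NExp.Fits, NExp.eval, h19]; omega
    simp only [NExp.eval, RExp.eval, hwel]
    refine ⟨(((h₁.mono (by decide) (by decide)).setReal (by decide) _ _).setNat
      (by decide) _ _).setNat (by decide) _ _, ?_, ?_, ?_, ?_⟩
    · rintro g' (rfl | hg')
      · simp
      · simpa using (hT.le_best g' hg').trans hb.le
    · right
      simp [h11, h19, htq, hcq, hg]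
    · simpa using hoth
    · simpa using hoth'
  · intro hb
    simp only [BExp.Holds, RExp.eval, NExp.eval, hwel, h₁.real 5 (by decide), not_lt] at hb
    refine Runs.skip (by omega) ⟨h₁.mono (by decide) (by decide), ?_, ?_, hoth, hoth'⟩
    · rw [h₁.real 5 (by decide)]
      rintro g' (rfl | hg')
      · exact hb
      · exact hT.le_best g' hg'
    · rw [h₁.real 5 (by decide), h₁.nat 25 (by decide), h₁.nat 26 (by decide)]
      exact hT.best

/-! ### The whole program -/

/-- Enumerates all assignments: for every polynomial without constant term the constants are
swept. -/
def enumerate : Program :=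
  .forLoop 11 5 (evalPoly ;; fillBuckets ;; .setVar 19 (.sub (.var 3) (.lit 1)) ;; setOwners ;;
    .forLoop 19 3 (sweepStep ;; assess ;; update))

/-- Restores the best assignment and computes the fees. -/
def finish : Program :=
  .ite (.realLt .zero (.var 5))
    (.setVar 11 (.var 25) ;; evalPoly ;; .setVar 19 (.var 26) ;; setOwners ;; assess ;;
      .forLoop 20 0 (.setReal 0 (.var 20) (.sub .one (.div (.get 3 (.var 20)) (.get 4 (.var 20))))))
    (.forLoop 12 1 (.setNat 2 (.var 12) (.lit 0)))

/-- The program for the mechanism. The integer arrays `0` to `5` hold `n`, `m`, the allocation,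
`q`, `n - 1` and `q ^ (n - 1)`, and `11` and `19` the number of the current polynomial and its
constant term; the real arrays `0` to `5` hold the fees, the values, an accumulator, the welfare of
the others, its maximum, and the highest welfare. -/
def mechanismProgram (K : ℕ) : Program := setup K ;; enumerate ;; finish

/-- The assignments whose numbers `(t', c')` precede `(t, c)`. -/
def enumerated (n q m : ℕ) [NeZero n] [NeZero q] (t c : ℕ) : Set (Fin m → Fin n) :=
  {g | ∃ t' c', (t' < t ∨ (t' = t ∧ c' < c)) ∧ c' < q ∧ g = assignment n q m t' c'}

/-- One round of the outer loop takes time `O(n ^ 2 * (q + m))`: summed over a sweep, the sizes of the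
emptied buckets amount to at most `m` for each player. -/
theorem runs_enumerate (hW : WordSize n m q W) (hc : Config n m q s)
    (h4 : ∀ i : Fin n, s.real 4 i = 0) (h5 : s.real 5 0 = 0) :
    Runs W v enumerate s
      (q ^ (n - 1) * (m * (61 * n + 102) + q * (26 * n ^ 2 + 124 * n + 88) + 63) + 9) fun s' =>
      AgreesOff [2, 11, 12, 13, 14, 15, 16, 17, 18, 19, 20, 21, 22, 23, 24, 25, 26] [1, 2, 3, 4, 5]
        s s' ∧ Tracks q v (enumerated n q m (q ^ (n - 1)) 0) s' := by
  have hn := hW.n_pos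
  have hnq := hW.le_q
  have hq : 0 < q := NeZero.pos q
  have hqW := hW.qn_le
  have hpow := hW.pow_le
  refine Runs.forLoop_const (N := q ^ (n - 1)) (fun t s' =>
    AgreesOff [2, 11, 12, 13, 14, 15, 16, 17, 18, 19, 20, 21, 22, 23, 24, 25, 26] [1, 2, 3, 4, 5]
      s s' ∧ Tracks q v (enumerated n q m t 0) s')
    (m * (61 * n + 102) + q * (26 * n ^ 2 + 124 * n + 88) + 51) (by decide) hc.pow_eq hpow
    (le_of_eq (by ring)) ⟨AgreesOff.refl.setNat (by decide) _ _, ?_⟩ ?_ fun s' h => h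
  · refine ⟨?_, Or.inl (by simpa using h5), ?_, fun i => Or.inl (by simpa using h4 i)⟩
    · rintro g ⟨t', c', h, -⟩; omega
    · rintro i g ⟨t', c', h, -⟩; omega
  rintro t s₁ ht ⟨h₁, hT₁⟩ hx hy
  have c₁ := hc.of_agreesOff h₁ (by decide)
  set y : ℕ → ℕ := fun j => horner q j t (n - 1) with hydef
  have hyq : ∀ j < m, y j < q := fun j _ => horner_lt hq _ _ _
  refine Runs.seq_of (runs_evalPoly hW c₁ hx (by omega)) (T₂ := m * (26 * n + 69) +
    q * (26 * n ^ 2 + 124 * n + 88) + 42) (by linarith) ?_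
  rintro s₂ ⟨h₂, h16⟩
  have c₂ := c₁.of_agreesOff h₂ (by decide)
  refine Runs.seq_of (runs_fillBuckets hW c₂ h16 hyq) (T₂ := m * (26 * n + 32) +
    q * (26 * n ^ 2 + 124 * n + 72) + 24) (by linarith) ?_
  rintro s₃ ⟨h₃, hB⟩
  have c₃ := c₂.of_agreesOff h₃ (by decide)
  refine Runs.setVar_seq ?_ (T' := m * (26 * n + 32) +
    q * (26 * n ^ 2 + 124 * n + 72) + 18) ?_ (by simp [NExp.cost]; omega)
  · simp only [NExp.Fits, NExp.eval, c₃.q_eq]; omega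
  have h19 : ∀ x, AgreesOff [19] [] s₃ (s₃.setNat 19 0 x) :=
    fun x => AgreesOff.refl.setNat (by decide) _ _
  simp only [NExp.eval, c₃.q_eq]
  refine Runs.seq_of (runs_setOwners (y := y) (c := q - 1) hW (c₃.of_agreesOff (h19 _) (by decide)) ?_
    hyq (by simp) (by omega)) (T₂ := m * (26 * n) + q * (26 * n ^ 2 + 124 * n + 72) + 9)
    (by linarith) ?_
  · intro j hj
    rw [(h19 _).nat 16 (by decide), h₃.nat 16 (by decide), h16 j hj]
  rintro s₄ ⟨h₄, hown⟩
  have a₄ : AgreesOff [2, 12, 13, 14, 15, 16, 17, 18, 19, 21] [] s₁ s₄ :=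
    (((h₂.mono (by decide) (by decide)).trans (h₃.mono (by decide) (by decide))).trans
      ((h19 _).mono (by decide) (by decide))).trans (h₄.mono (by decide) (by decide))
  have c₄ := c₁.of_agreesOff a₄ (by decide)
  have hB₄ : Buckets m q y m s₄ := hB.congr
    (by rw [h₄.nat 17 (by decide), (h19 _).nat 17 (by decide)])
    (by rw [h₄.nat 18 (by decide), (h19 _).nat 18 (by decide)])
  have ht₄ : s₄.nat 11 0 = t := by rw [a₄.nat 11 (by decide), hx]
  refine Runs.forLoop (N := q) (fun c s' =>
    AgreesOff [2, 19, 20, 21, 22, 23, 24, 25, 26] [1, 2, 3, 4, 5] s₄ s' ∧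
      (∀ j < m, s'.nat 2 j = ownerCode n q (y j) (c + (q - 1))) ∧
      Tracks q v (enumerated n q m t c) s')
    (fun c => 26 * (∑ i ∈ Finset.range n, bucketSize y m (movingValue n q i c)) +
      (26 * n ^ 2 + 124 * n + 60)) (by decide) c₄.q_eq (by omega) ?_
    ⟨AgreesOff.refl.setNat (by decide) _ _, ?_, ?_⟩ ?_ ?_
  · -- The total number of moves in a sweep.
    have hsum : ∑ c ∈ Finset.range q, ∑ i ∈ Finset.range n,
        bucketSize y m (movingValue n q i c) ≤ n * m := by
      rw [Finset.sum_comm]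
      calc _ ≤ ∑ i ∈ Finset.range n, m := Finset.sum_le_sum fun i hi =>
            sum_bucketSize_movingValue (Finset.mem_range.1 hi) hnq
        _ = n * m := by simp
    rw [Finset.sum_add_distrib, Finset.sum_add_distrib, ← Finset.mul_sum]
    simp only [Finset.sum_const, Finset.card_range, smul_eq_mul]
    nlinarith
  · intro j hj
    simpa using hown j hj
  · refine hT₁.congr le_rfl (a₄.trans (AgreesOff.refl.setNat (by decide) _ _))
      (by decide) (by decide) (by decide) (by decide)
  · rintro c s₅ hcq ⟨h₅, hown₅, hT₅⟩ hx₅ hy₅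
    have c₅ := c₄.of_agreesOff h₅ (by decide)
    have hB₅ : Buckets m q y m s₅ := hB₄.congr (h₅.nat 17 (by decide)) (h₅.nat 18 (by decide))
    refine Runs.seq_of (runs_sweepStep hW c₅ hyq hB₅ hx₅ hcq hown₅)
      (T₂ := 26 * n ^ 2 + 76 * n + 51) (le_of_eq ?_) ?_
    · rw [Finset.sum_add_distrib, ← Finset.mul_sum]
      simp only [Finset.sum_const, Finset.card_range, smul_eq_mul]
      ring
    rintro s₆ ⟨h₆, hown₆⟩
    have c₆ := c₅.of_agreesOff h₆ (by decide)
    refine Runs.seq_of (runs_assess (g := assignment n q m t c) hW c₆ fun j => hown₆ j j.2)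
      (T₂ := 26 * n + 33) (by omega) ?_
    rintro s₇ ⟨h₇, ha₇⟩
    have a₇ : AgreesOff [2, 20, 21, 22, 23, 24] [1, 2, 3] s₅ s₇ :=
      (h₆.mono (by decide) (by decide)).trans (h₇.mono (by decide) (by decide))
    have c₇ := c₆.of_agreesOff h₇ (by decide)
    have ht₇ : s₇.nat 11 0 = t := by
      rw [a₇.nat 11 (by decide), h₅.nat 11 (by decide), ht₄]
    have hc₇ : s₇.nat 19 0 = c := by rw [a₇.nat 19 (by decide), hx₅]
    refine (runs_update hW c₇ ht₇ hc₇ ht hcq ha₇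
      (hT₅.congr le_rfl a₇ (by decide) (by decide) (by decide) (by decide))).mono le_rfl ?_
    rintro s₈ ⟨h₈, hT₈⟩
    have a₈ : AgreesOff [2, 20, 21, 22, 23, 24, 25, 26] [1, 2, 3, 4, 5] s₅ s₈ :=
      (a₇.mono (by decide) (by decide)).trans (h₈.mono (by decide) (by decide))
    refine ⟨by rw [a₈.nat 19 (by decide), hx₅], by rw [a₈.nat 3 (by decide), hy₅],
      (h₅.trans (a₈.mono (by decide) (by decide))).setNat (by decide) _ _, ?_, ?_⟩
    · intro j hj
      have e : (s₈.setNat 19 0 (c + 1)).nat 2 j = s₈.nat 2 j := by simp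
      rw [e, h₈.nat 2 (by decide), h₇.nat 2 (by decide), hown₆ j hj, ownerCode, ownerCode,
        show y j + (c + 1 + (q - 1)) = y j + c + q by omega, Nat.add_mod_right]
    · refine hT₈.congr (A := [19]) (B := []) ?_ (AgreesOff.refl.setNat (by decide) _ _)
        (by decide) (by decide) (by decide) (by decide)
      rintro g ⟨t', c', h, hc', rfl⟩
      rcases h with h | ⟨rfl, h⟩
      · exact Or.inr ⟨t', c', Or.inl h, hc', rfl⟩
      · rcases Nat.lt_succ_iff_lt_or_eq.1 h with h | rfl
        · exact Or.inr ⟨t', c', Or.inr ⟨rfl, h⟩, hc', rfl⟩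
        · exact Or.inl rfl
  · rintro s₅ ⟨h₅, -, hT₅⟩
    have a₅ : AgreesOff [2, 12, 13, 14, 15, 16, 17, 18, 19, 20, 21, 22, 23, 24, 25, 26]
        [1, 2, 3, 4, 5] s₁ s₅ :=
      (a₄.mono (by decide) (by decide)).trans (h₅.mono (by decide) (by decide))
    refine ⟨by rw [a₅.nat 11 (by decide), hx], by rw [a₅.nat 5 (by decide), hy],
      (h₁.trans (a₅.mono (by decide) (by decide))).setNat (by decide) _ _, ?_⟩
    refine hT₅.congr (A := [11]) (B := []) ?_ (AgreesOff.refl.setNat (by decide) _ _)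
      (by decide) (by decide) (by decide) (by decide)
    rintro g ⟨t', c', h, hc', rfl⟩
    rcases h with h | ⟨rfl, h⟩
    · rcases Nat.lt_succ_iff_lt_or_eq.1 h with h | rfl
      · exact ⟨t', c', Or.inl h, hc', rfl⟩
      · exact ⟨t', c', Or.inr ⟨rfl, hc'⟩, hc', rfl⟩
    · omega

end

section

variable {n m q W : ℕ} {v : Fin n → Valuation m} {s s' : Store}

theorem mem_enumerated [NeZero n] [NeZero q] {g : Fin m → Fin n}
    (hg : g ∈ Set.range (sample (n := n) (q := q) m)) :
    g ∈ enumerated n q m (q ^ (n - 1)) 0 := by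
  rw [range_sample_eq] at hg
  obtain ⟨t, c, ht, hc, rfl⟩ := hg
  exact ⟨t, c, Or.inl ht, hc, rfl⟩

/-- If the highest welfare is positive, then so are all the maxima for the others, and each is
attained; otherwise nothing is allocated, and the fees keep their initial value `0`. -/
theorem runs_finish [NeZero n] [NeZero q] (hW : WordSize n m q W) (hc : Config n m q s)
    (h0 : ∀ i : Fin n, s.real 0 i = 0)
    (hT : Tracks q v (enumerated n q m (q ^ (n - 1)) 0) s) :
    Runs W v finish s (m * (35 * n + 65) + 26 * n ^ 2 + 74 * n + 58) fun s' =>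
      ∃ a, IsOutcome (Set.range (sample (n := n) (q := q) m)) v a (fun i => s'.real 0 i) ∧
        ∀ j : Fin m, s'.nat 2 j = (a j).elim 0 fun i => (i : ℕ) + 1 := by
  have hn := hW.n_pos
  have hq : 0 < q := NeZero.pos q
  have hqW := hW.qn_le
  have hpow := hW.pow_le
  have hmW := hW.m_le
  refine Runs.ite (T' := m * (35 * n + 65) + 26 * n ^ 2 + 74 * n + 53)
    (by simp [BExp.Fits, RExp.Fits, NExp.Fits])
    (by simp [BExp.cost, NExp.cost, RExp.cost]; omega) ?_ ?_
  · intro hb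
    simp only [BExp.Holds, RExp.eval, NExp.eval] at hb
    obtain ⟨htb, hcb, hbest⟩ := hT.best.resolve_left hb.ne'
    set t := s.nat 25 0 with ht
    set c := s.nat 26 0 with hcdef
    set g := assignment n q m t c with hg
    have hgR : g ∈ Set.range (sample (n := n) (q := q) m) := by
      rw [range_sample_eq]; exact ⟨t, c, htb, hcb, rfl⟩
    have hpos : 0 < welfare v (full g) := hbest ▸ hb
    have hB : ∀ i : Fin n, othersWelfare v i (full g) ≤ s.real 4 i := fun i =>
      hT.le_others i g (mem_enumerated hgR)
    -- The ratios of the fees are never divisions by zero.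
    have hBpos : ∀ i : Fin n, 0 < s.real 4 i := fun i => (othersWelfare_pos hpos i).trans_le (hB i)
    set y : ℕ → ℕ := fun j => horner q j t (n - 1) with hydef
    have hyq : ∀ j < m, y j < q := fun j _ => horner_lt hq _ _ _
    have a₁ : ∀ x, AgreesOff [11] [] s (s.setNat 11 0 x) :=
      fun x => AgreesOff.refl.setNat (by decide) _ _
    refine Runs.setVar_seq ?_ (T' := m * (35 * n + 65) + 26 * n ^ 2 + 74 * n + 49) ?_
      (by simp [NExp.cost]; omega)
    · simp only [NExp.Fits, NExp.eval]; omega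
    change Runs W v _ (s.setNat 11 0 t) _ _
    have c₁ := hc.of_agreesOff (a₁ t) (by decide)
    refine Runs.seq_of (runs_evalPoly (t := t) hW c₁ (by simp) (by omega))
      (T₂ := m * 32 + 26 * n ^ 2 + 74 * n + 40) (by linarith) ?_
    rintro s₂ ⟨h₂, h16⟩
    have c₂ := c₁.of_agreesOff h₂ (by decide)
    have e26 : s₂.nat 26 0 = c := by rw [h₂.nat 26 (by decide), (a₁ t).nat 26 (by decide)]
    refine Runs.setVar_seq ?_ (T' := m * 32 + 26 * n ^ 2 + 74 * n + 36) ?_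
      (by simp [NExp.cost]; omega)
    · simp only [NExp.Fits, NExp.eval, e26]; omega
    simp only [NExp.eval, e26]
    have a₃ : AgreesOff [19] [] s₂ (s₂.setNat 19 0 c) := AgreesOff.refl.setNat (by decide) _ _
    have c₃ := c₂.of_agreesOff a₃ (by decide)
    refine Runs.seq_of (runs_setOwners (y := y) (c := c) hW c₃
      (fun j hj => by rw [a₃.nat 16 (by decide), h16 j hj]) hyq (by simp) hcb)
      (T₂ := 26 * n ^ 2 + 74 * n + 27) (by linarith) ?_
    rintro s₄ ⟨h₄, hown⟩
    have c₄ := c₃.of_agreesOff h₄ (by decide)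
    refine Runs.seq_of (runs_assess (g := g) hW c₄ fun j => hown j j.2)
      (T₂ := 24 * n + 9) (by linarith) ?_
    rintro s₅ ⟨h₅, ha₅⟩
    have c₅ := c₄.of_agreesOff h₅ (by decide)
    have r₅ : ∀ b, b ∉ [1, 2, 3] → s₅.real b = s.real b := fun b hb => by
      rw [h₅.real b hb, h₄.real b (by simp), a₃.real b (by simp), h₂.real b (by simp),
        (a₁ t).real b (by simp)]
    refine Runs.forLoop_const (N := n) (fun k s' => AgreesOff [20] [0] s₅ s' ∧ ∀ i : Fin n,
      (i : ℕ) < k → s'.real 0 i = 1 - othersWelfare v i (full g) / s.real 4 i) 12 (by decide)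
      c₅.n_eq (by omega) (by omega) ⟨AgreesOff.refl.setNat (by decide) _ _, by simp⟩ ?_ ?_
    · rintro k s₆ hk ⟨h₆, hf⟩ hx hy
      have e3 : s₆.real 3 k = othersWelfare v ⟨k, hk⟩ (full g) := by
        rw [h₆.real 3 (by decide)]; exact ha₅.others ⟨k, hk⟩
      have e4 : s₆.real 4 k = s.real 4 k := by rw [h₆.real 4 (by decide), r₅ 4 (by decide)]
      have hfits : NExp.Fits W s₆ (.var 20) := by simp [NExp.Fits, NExp.eval, hx]; omega
      refine Runs.setReal hfits ⟨trivial, hfits, hfits, ?_⟩ (by simp [NExp.cost, RExp.cost])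
        ⟨by simp [hx], by simp [hy], (h₆.setReal (by decide) _ _).setNat (by decide) _ _, ?_⟩
      · simp only [RExp.eval, NExp.eval, hx, e4]
        exact (hBpos ⟨k, hk⟩).ne'
      · intro i hi
        simp only [RExp.eval, NExp.eval, hx, e3, e4, Store.setNat_real, Store.setReal_real,
          true_and]
        split_ifs with e
        · have e' : i = ⟨k, hk⟩ := Fin.ext e
          subst e'
          rfl
        · exact hf i (by omega)
    · rintro s₆ ⟨h₆, hf⟩
      refine ⟨full g, Or.inl ⟨g, hgR, fun g' hg' => ?_, hpos, rfl, fun i => ⟨s.real 4 i, ?_,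
        hf i i.2⟩⟩, fun j => ?_⟩
      · rw [← hbest]
        exact hT.le_best g' (mem_enumerated hg')
      · obtain ⟨t', c', ht', hc', hB'⟩ := (hT.others i).resolve_left (hBpos i).ne'
        refine ⟨⟨assignment n q m t' c', ?_, hB'.symm⟩, ?_⟩
        · rw [range_sample_eq]; exact ⟨t', c', ht', hc', rfl⟩
        · rintro _ ⟨g', hg', rfl⟩
          exact hT.le_others i g' (mem_enumerated hg')
      · rw [h₆.nat 2 (by decide), h₅.nat 2 (by decide), hown j j.2]
        rfl
  · intro hb
    simp only [BExp.Holds, RExp.eval, NExp.eval, not_lt] at hb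
    refine Runs.forLoop_const (N := m) (fun k s' => AgreesOff [2, 12] [] s s' ∧
      ∀ j < k, s'.nat 2 j = 0) 4 (by decide) hc.m_eq hmW (by nlinarith)
      ⟨AgreesOff.refl.setNat (by decide) _ _, by simp⟩ ?_ ?_
    · rintro k s₁ hk ⟨h₁, h2⟩ hx hy
      refine Runs.setNat ?_ (Nat.zero_le _) (by simp [NExp.cost]) ⟨by simp [hx], by simp [hy],
        (h₁.setNat (by decide) _ _).setNat (by decide) _ _, ?_⟩
      · simp [NExp.Fits, NExp.eval, hx]; omega
      · intro j hj
        simp only [NExp.eval, Store.setNat_nat, hx]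
        by_cases e : j = k
        · simp [e]
        · simp [e, h2 j (by omega)]
    · rintro s₁ ⟨h₁, h2⟩
      refine ⟨nullAllocation n m, Or.inr ⟨fun g hg => ?_, rfl, fun i => ?_⟩, fun j => ?_⟩
      · exact (hT.le_best g (mem_enumerated hg)).trans hb
      · exact (congrFun (h₁.real 0 (by decide)) _).trans (h0 i)
      · simp [h2 j j.2, nullAllocation]

/-! ### Resources -/

/-- The time for the whole program: `setup`, `enumerate` and `finish`. -/
def totalTime (n m q L : ℕ) : ℕ :=
  56 * L ^ 2 + 45 * L + 19 * n + 50 +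
    (q ^ (n - 1) * (m * (61 * n + 102) + q * (26 * n ^ 2 + 124 * n + 88) + 63) + 9 +
      (m * (35 * n + 65) + 26 * n ^ 2 + 74 * n + 58))

theorem runs_mechanismProgram {K L : ℕ} [NeZero n] [NeZero (lastPrime L L)]
    (hL : L = n * K + (n - 1) * m) (hK : 1 ≤ K) (hW : WordSize n m (lastPrime L L) W)
    (hLW : 2 * L ≤ W) (v : Fin n → Valuation m) :
    Runs W v (mechanismProgram K) (initialStore n m) (totalTime n m (lastPrime L L) L) fun s' =>
      ∃ a, IsOutcome (Set.range (sample (n := n) (q := lastPrime L L) m)) v a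
          (fun i => s'.real 0 i) ∧
        ∀ j : Fin m, s'.nat 2 j = (a j).elim 0 fun i => (i : ℕ) + 1 := by
  refine Runs.seq_of (runs_setup rfl hL hK hW hLW) le_rfl ?_
  rintro s₁ ⟨h₁, c₁⟩
  have r₁ : s₁.real = fun _ _ => 0 := by
    funext b
    rw [h₁.real b (by simp)]
    rfl
  refine Runs.seq_of (runs_enumerate hW c₁ (by simp [r₁]) (by simp [r₁])) le_rfl ?_
  rintro s₂ ⟨h₂, hT⟩
  exact runs_finish hW (c₁.of_agreesOff h₂ (by decide))
    (fun i => by rw [h₂.real 0 (by decide), r₁]) hT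

/-- The range of the primes is linear in `m` for two or more players, and bounded for a single
player, so that quadratic time in it is affordable. -/
theorem prime_range_bounds {n K : ℕ} (hn : 1 ≤ n) {m L : ℕ} (hm : 1 ≤ m)
    (hL : L = n * K + (n - 1) * m) :
    L ≤ (n * K + n) * m ∧ L * (L + m) ≤ ((n * K + n) * (n * K + n + 1)) * m ^ n := by
  have h1 : L ≤ (n * K + n) * m := by
    rw [hL, add_mul]
    exact add_le_add (Nat.le_mul_of_pos_right _ hm) (Nat.mul_le_mul_right m (Nat.sub_le n 1))
  refine ⟨h1, ?_⟩
  rcases Nat.lt_or_ge 1 n with h2 | h2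
  · calc L * (L + m) ≤ ((n * K + n) * m) * ((n * K + n) * m + m) := by gcongr
      _ = ((n * K + n) * (n * K + n + 1)) * m ^ 2 := by ring
      _ ≤ _ := Nat.mul_le_mul_left _ (Nat.pow_le_pow_right hm h2)
  · have hn1 : n = 1 := le_antisymm h2 hn
    subst hn1
    have hLK : L = K := by simpa using hL
    rw [hLK, pow_one]
    calc K * (K + m) ≤ K * (K * m + m) := by
          gcongr
          exact Nat.le_mul_of_pos_right K hm
      _ = K * (K + 1) * m := by ring
      _ ≤ _ := by gcongr <;> omega

/-- With `d = n * K + n`, the prime is at most `2 * d * m`, and quantities quadratic in `L` and `m`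
are at most a constant times `d * (d + 1) * m ^ n`. -/
theorem exists_resource_bound {n : ℕ} (hn : 1 ≤ n) (K : ℕ) (hK : 1 ≤ K) :
    ∃ C : ℕ, ∀ m L : ℕ, 1 ≤ m → L = n * K + (n - 1) * m →
      WordSize n m (lastPrime L L) (C * m ^ n) ∧ 2 * L ≤ C * m ^ n ∧
        totalTime n m (lastPrime L L) L ≤ C * m ^ n := by
  set d := n * K + n with hd
  set e := d * (d + 1) with he
  refine ⟨56 * e + 45 * d + 19 * n + 50 + ((2 * d) ^ (n - 1) * ((61 * n + 102) +
    2 * d * (26 * n ^ 2 + 124 * n + 88) + 63) + 9 + ((35 * n + 65) + 26 * n ^ 2 + 74 * n + 58)) +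
    4 * e + 2 * d * n + 4 * d, fun m L hm hL => ?_⟩
  obtain ⟨hLm, hLLm⟩ := prime_range_bounds hn hm hL
  have hnK : n ≤ n * K := Nat.le_mul_of_pos_right n hK
  obtain ⟨hp, hLq, hqL⟩ := lastPrime_bertrand (L := L) (by omega)
  set q := lastPrime L L
  rw [← hd] at hLm hLLm
  rw [← he] at hLLm
  set M := m ^ n with hM
  have hmM : m ≤ M := Nat.le_self_pow (by omega) m
  have hM1 : 1 ≤ M := hm.trans hmM
  have hLM : L ≤ d * M := hLm.trans (Nat.mul_le_mul_left d hmM)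
  have hqm : q ≤ 2 * d * m := by rw [mul_assoc]; omega
  have hLsq : L ^ 2 ≤ e * M := le_trans (by nlinarith) hLLm
  have hqmM : q * m ≤ 2 * (e * M) := by
    calc q * m ≤ 2 * L * m := Nat.mul_le_mul_right m hqL
      _ = 2 * (L * m) := by ring
      _ ≤ 2 * (L * (L + m)) := by gcongr; omega
      _ ≤ _ := by omega
  have hpow : ∀ x y : ℕ, x ≤ y * m → q ^ (n - 1) * x ≤ (2 * d) ^ (n - 1) * y * M := by
    intro x y hxy
    calc q ^ (n - 1) * x ≤ (2 * d * m) ^ (n - 1) * (y * m) := by gcongr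
      _ = (2 * d) ^ (n - 1) * y * (m ^ (n - 1) * m) := by rw [mul_pow]; ring
      _ = _ := by rw [← pow_succ, Nat.sub_add_cancel hn]
  have hconst : ∀ x : ℕ, x ≤ x * M := fun x => Nat.le_mul_of_pos_right x hM1
  set F := 26 * n ^ 2 + 124 * n + 88 with hF
  have hmain : q ^ (n - 1) * (m * (61 * n + 102) + q * F + 63)
      ≤ (2 * d) ^ (n - 1) * ((61 * n + 102) + 2 * d * F + 63) * M := by
    refine hpow _ _ ?_
    have h1 : q * F ≤ 2 * d * m * F := Nat.mul_le_mul_right F hqm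
    nlinarith
  have hpow1 : q ^ (n - 1) ≤ (2 * d) ^ (n - 1) * M := by
    simpa using hpow 1 1 (by omega)
  have hbig : (2 * d) ^ (n - 1) * M
      ≤ (2 * d) ^ (n - 1) * ((61 * n + 102) + 2 * d * F + 63) * M :=
    Nat.mul_le_mul_right M (Nat.le_mul_of_pos_right _ (by omega))
  set G := (2 * d) ^ (n - 1) * ((61 * n + 102) + 2 * d * F + 63)
  have hqn : q * n ≤ 2 * d * n * M := by
    calc q * n ≤ (2 * (d * M)) * n := Nat.mul_le_mul_right n (by omega)
      _ = _ := by ring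
  have hexp : (56 * e + 45 * d + 19 * n + 50 + (G + 9 +
      ((35 * n + 65) + 26 * n ^ 2 + 74 * n + 58)) + 4 * e + 2 * d * n + 4 * d) * M
      = 56 * (e * M) + 45 * (d * M) + 19 * (n * M) + 50 * M + (G * M + 9 * M +
      ((35 * n + 65) * M + 26 * (n ^ 2 * M) + 74 * (n * M) + 58 * M)) + 4 * (e * M)
      + 2 * d * n * M + 4 * (d * M) := by ring
  rw [hexp]
  have hnM := hconst n
  have hn2M := hconst (n ^ 2)
  have hm35 : m * (35 * n + 65) ≤ (35 * n + 65) * M := by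
    rw [mul_comm]; exact Nat.mul_le_mul_left _ hmM
  refine ⟨⟨hn, by omega, hm, by omega, by omega, by omega, by omega⟩, by omega, ?_⟩
  rw [totalTime, ← hF]
  omega

end

end PercentageFee

theorem mainTheorem5 :
    ∃ c : ℝ, 0 < c ∧
      ∀ ε : ℝ, 0 < ε →
        ∃ P : PercentageFee.Program,
          ∀ n : ℕ, 1 ≤ n →
            ∃ C : ℕ, ∀ m : ℕ, 1 ≤ m →
              ∃ M : PercentageFee.Mechanism n m,
                M.FeesInRange ∧
                M.IncentiveCompatible ∧
                (∃ D : PMF (Fin m → Fin n),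
                  PercentageFee.KWiseIndependent n D ∧
                  PercentageFee.NearlyUniform ε D ∧
                  M.MaximalInRange (PercentageFee.supportRange D)) ∧
                PercentageFee.Computes P M (C * m ^ n) (C * m ^ n) ∧
                (∀ v : Fin n → PercentageFee.Valuation m, (∀ i, (v i).IsXOS) →
                  M.ApproximatesNSW ((1 + ε) * n) v) ∧
                (∀ v : Fin n → PercentageFee.Valuation m, (∀ i, (v i).IsSubadditive) →
                  2 ≤ m → M.ApproximatesNSW (c * (n * Real.log m)) v) := by
  open PercentageFee in
  -- A factor `3` bounds the harmonic number by `log m`, and a factor `2` the loss of uniformity.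
  refine ⟨6, by norm_num, fun ε hε => ?_⟩
  -- The owners of the items are uniform up to a relative error of `1 / K`.
  obtain ⟨K, hK⟩ := exists_nat_ge (max 2 ((1 + ε) / ε))
  have hK2 : (2 : ℝ) ≤ K := (le_max_left _ _).trans hK
  have hK0 : (0 : ℝ) < K := by linarith
  have hKε : 1 / (K : ℝ) ≤ ε / (1 + ε) := by
    rw [div_le_div_iff₀ hK0 (by linarith), one_mul, ← div_le_iff₀' hε]
    exact (le_max_right _ _).trans hK
  have hK1 : 1 ≤ K := by
    have : (1 : ℝ) ≤ K := by linarith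
    exact_mod_cast this
  have hδ2 : 1 / (K : ℝ) ≤ 1 / 2 := one_div_le_one_div_of_le (by norm_num) hK2
  have hδ0 : 0 < 1 - 1 / (K : ℝ) := by linarith
  refine ⟨mechanismProgram K, fun n hn => ?_⟩
  obtain ⟨C, hC⟩ := exists_resource_bound hn K hK1
  refine ⟨C, fun m hm => ?_⟩
  set L := n * K + (n - 1) * m with hL
  obtain ⟨hW, hLW, hT⟩ := hC m L hm hL
  have hnK : n ≤ n * K := Nat.le_mul_of_pos_right n hK1
  obtain ⟨hp, hLq, -⟩ := lastPrime_bertrand (L := L) (by omega)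
  have : NeZero n := ⟨by omega⟩
  have : Fact (lastPrime L L).Prime := ⟨hp⟩
  have hrun := runs_mechanismProgram hL hK1 hW hLW
  set q := lastPrime L L with hq
  -- The outcome of the mechanism is read off from the final memory of the program.
  choose! s t hexec ht a ha hout using hrun
  have hinj : ∀ J : Finset (Fin m), J.card ≤ n →
      Set.InjOn (fun j : Fin m => ((j : ℕ) : ZMod q)) J := fun J hJ =>
    injOn_items (by omega) hJ
  have hδ : (n : ℝ) ≤ 1 / K * q := by
    rw [div_mul_eq_mul_div, one_mul, le_div_iff₀ hK0]
    have : n * K ≤ q := by omega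
    exact_mod_cast this
  have hδε : 1 / (K : ℝ) ≤ ε := hKε.trans (div_le_self hε.le (by linarith))
  have hinv : 1 / (1 - 1 / (K : ℝ)) ≤ 1 + ε := by
    rw [div_le_iff₀ hδ0]
    have h1 : (1 + ε) * (1 / (K : ℝ)) ≤ ε := by
      rw [← le_div_iff₀' (by linarith)]
      exact hKε
    linarith
  have hinv2 : 1 / (1 - 1 / (K : ℝ)) ≤ 2 := by
    rw [div_le_iff₀ hδ0]
    linarith
  have hmono : ∀ (M : Mechanism n m) (v : Fin n → Valuation m) (α β : ℝ), α ≤ β →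
      M.ApproximatesNSW α v → M.ApproximatesNSW β v := fun M v α β hαβ h b =>
    (h b).trans (mul_le_mul_of_nonneg_right hαβ
      (Real.rpow_nonneg (welfare_nonneg v _) _))
  let M : Mechanism n m := ⟨a, fun v i => (s v).real 0 i⟩
  have hM : ∀ v, IsOutcome (Set.range (sample (n := n) (q := q) m)) v (M.alloc v) (M.fee v) := ha
  have hM' : ∀ v, IsOutcome (sampleDist n m q).support v (M.alloc v) (M.fee v) := by
    rw [support_sampleDist]; exact hM
  refine ⟨M, feesInRange_of_isOutcome hM, incentiveCompatible_of_isOutcome hM,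
    ⟨sampleDist n m q, kWiseIndependent_sampleDist hinj,
      nearlyUniform_sampleDist (hδ.trans (by gcongr)), maximalInRange_of_isOutcome hM'⟩,
    fun v => ⟨s v, t v, hexec v, (ht v).trans hT, hout v, fun i => rfl⟩, fun v hv => ?_,
    fun v hv hm2 => ?_⟩
  · refine hmono M v _ _ ?_ (approximatesNSW_of_isSupported hδ (by linarith) zero_le_one hinj v
      (fun i => (hv i).isSupported) (hM v))
    calc 1 * (n : ℝ) / (1 - 1 / K) = 1 / (1 - 1 / (K : ℝ)) * n := by ring
      _ ≤ (1 + ε) * n := by gcongr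
  · have hpos : (0 : ℝ) < harmonic m := by exact_mod_cast harmonic_pos (by omega)
    refine hmono M v _ _ ?_ (approximatesNSW_of_isSupported hδ (by linarith) hpos.le hinj v
      (fun i => (hv i).isSupported hm) (hM v))
    have hlog : (harmonic m : ℝ) ≤ 3 * Real.log m := by
      have h1 := harmonic_le_one_add_log m
      have h2 : Real.log 2 ≤ Real.log m :=
        Real.log_le_log (by norm_num) (by exact_mod_cast hm2)
      have h3 := Real.log_two_gt_d9
      linarith
    calc (harmonic m : ℝ) * n / (1 - 1 / K) = harmonic m * n * (1 / (1 - 1 / (K : ℝ))) := by ring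
      _ ≤ 3 * Real.log m * n * 2 := by
        have : (0 : ℝ) ≤ 3 * Real.log m := hpos.le.trans hlog
        gcongr
      _ = 6 * (n * Real.log m) := by ring
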